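/- Let $\beta>0$ and $\lambda>0$. Let $\alpha,\varepsilon:[0,\infty)\to\mathbb{R}$ be non-increasing and three times continuously differentiable, with $\alpha\ge 0$ and $\varepsilon>0$, and suppose that $\varepsilon(0)<\frac{(\beta\lambda)^2}{2|\alpha'(t)|+4\lambda}$ for all $t\ge 0$. Suppose also that the first, second and third derivatives of $\alpha$ and of $\varepsilon$ are integrable on $[0,\infty)$, that $\varepsilon(t)\to 0$ as $t\to\infty$, that $\varepsilon'(t)^2/\varepsilon(t)$ is integrable on $[0,\infty)$, and that $\varepsilon'(t)=o(\varepsilon(t))$ as $t\to\infty$. Consider the scalar equation $$\varepsilon(t)\ddot x(t)+(\alpha(t)+\beta\lambda)\dot x(t)+\lambda x(t)=0,\qquad t\ge 0,\qquad(\mathrm{E})$$ which is satisfied by the coordinates, in an eigenbasis of $\nabla^2 f$, of the trajectories of $\varepsilon\ddot x+\alpha\dot x+\beta\nabla^2 f(x)\dot x+\nabla f(x)=0$ for quadratic $f$. Put $$p=\frac{\alpha+\beta\lambda}{\varepsilon},\qquad r=\frac{p^2}{4}+\frac{p'}{2}-\frac{\lambda}{\varepsilon},\qquad \varphi=\frac{4rr''-5(r')^2}{16\,r^{5/2}}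 .$$ Then $r>0$ on $[0,\infty)$, $\int_0^\infty|\varphi(s)|\,ds<\infty$, and the functions $\eta_1,\eta_2$ defined on $[0,\infty)$ by $$-\frac p2+\sqrt r=\frac{\alpha'}{2(\alpha+\beta\lambda)}-\frac{\varepsilon'}{2\varepsilon}-\frac{\lambda}{\alpha+\beta\lambda}-\frac{\lambda^2\varepsilon}{(\alpha+\beta\lambda)^3}+\eta_1,$$ $$-\frac p2-\sqrt r=-\frac{\alpha'}{2(\alpha+\beta\lambda)}+\frac{\varepsilon'}{2\varepsilon}-\frac{\alpha+\beta\lambda}{\varepsilon}+\frac{\lambda}{\alpha+\beta\lambda}+\frac{\lambda^2\varepsilon}{(\alpha+\beta\lambda)^3}+\eta_2$$ satisfy $\eta_1(t)=o(\varepsilon(t))$ and $\eta_2(t)=o(\varepsilon(t))$ as $t\to\infty$. For functions $\delta_1,\delta_2$ on $[0,\infty)$ write $$u_1[\delta_1](t)=\frac{1+\delta_1(t)}{r(t)^{1/4}}\frac{\sqrt{\alpha(t)+\beta\lambda}}{\sqrt{\varepsilon(t)}}\exp\Big(\int_0^t-\frac{\lambda}{\alpha(s)+\beta\lambda}-\frac{\lambda^2\varepsilon(s)}{(\alpha(s)+\beta\lambda)^3}+\eta_1(s)\,ds\Big),$$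 $$u_2[\delta_2](t)=\frac{1+\delta_2(t)}{r(t)^{1/4}}\frac{\sqrt{\varepsilon(t)}}{\sqrt{\alpha(t)+\beta\lambda}}\exp\Big(\int_0^t-\frac{\alpha(s)+\beta\lambda}{\varepsilon(s)}+\frac{\lambda}{\alpha(s)+\beta\lambda}+\frac{\lambda^2\varepsilon(s)}{(\alpha(s)+\beta\lambda)^3}+\eta_2(s)\,ds\Big),$$ and say that $(\delta_1,\delta_2)$ is admissible if for all $t\ge 0$ $$|\delta_1(t)|\le\exp\Big(\tfrac12\int_0^t|\varphi(s)|\,ds\Big)-1,\qquad |\delta_2(t)|\le\exp\Big(\tfrac12\int_t^\infty|\varphi(s)|\,ds\Big)-1 .$$ Then there is an admissible pair $(\delta_1,\delta_2)$ for which $u_1[\delta_1]$ and $u_2[\delta_2]$ are both exact solutions of (E). Moreover, for all $x_0,\dot x_0\in\mathbb{R}$ the equation (E) has exactly one solution $x$ on $[0,\infty)$ with $x(0)=x_0$ and $\dot x(0)=\dot x_0$, and there are $A,B\in\mathbb{R}$ and an admissible pair of continuous functions $(\delta_1,\delta_2)$ such that $$x(t)=A\,u_1[\delta_1](t)+B\,u_2[\delta_2](t)\qquad\text{for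 all }t\ge 0 .$$ -/

import Mathlib

open Set Filter Topology MeasureTheory Asymptotics

noncomputable section

/-- Derivative of a function of time on the half-line `[0, ∞)` (one-sided at `0`). -/
def dt (f : ℝ → ℝ) : ℝ → ℝ := derivWithin f (Ici 0)

/-- `x` is a (twice differentiable) solution on `[0, ∞)` of
`ε x'' + (α + β lam) x' + lam x = 0`. -/
def IsSolution (ε α : ℝ → ℝ) (β lam : ℝ) (x : ℝ → ℝ) : Prop :=
  ∃ v a : ℝ → ℝ, ∀ t : ℝ, 0 ≤ t →
    HasDerivWithinAt x (v t) (Ici 0) t ∧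
    HasDerivWithinAt v (a t) (Ici 0) t ∧
    ε t * a t + (α t + β * lam) * v t + lam * x t = 0

/-- `p = (α + β lam) / ε`. -/
def pFun (ε α : ℝ → ℝ) (β lam : ℝ) (t : ℝ) : ℝ := (α t + β * lam) / ε t

/-- `r = p² / 4 + p' / 2 - lam / ε`. -/
def rFun (ε α : ℝ → ℝ) (β lam : ℝ) (t : ℝ) : ℝ :=
  pFun ε α β lam t ^ 2 / 4 + dt (pFun ε α β lam) t / 2 - lam / ε t

/-- `φ = (4 r r'' - 5 r'²) / (16 r^(5/2))`. -/
def phiFun (ε α : ℝ → ℝ) (β lam : ℝ) (t : ℝ) : ℝ :=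
  (4 * rFun ε α β lam t * dt (dt (rFun ε α β lam)) t - 5 * dt (rFun ε α β lam) t ^ 2) /
    (16 * rFun ε α β lam t ^ (5 / 2 : ℝ))

/-- The first (slow) Liouville-Green term, with relative error `δ` and with `η` standing for the
remainder in the exponent. -/
def lgTerm₁ (ε α : ℝ → ℝ) (β lam : ℝ) (δ η : ℝ → ℝ) (t : ℝ) : ℝ :=
  (1 + δ t) / rFun ε α β lam t ^ (1 / 4 : ℝ) * (√(α t + β * lam) / √(ε t)) *
    Real.exp (∫ s in (0 : ℝ)..t,
      (-(lam / (α s + β * lam)) - lam ^ 2 * ε s / (α s + β * lam) ^ 3 + η s))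

/-- The second (fast) Liouville-Green term, with relative error `δ` and with `η` standing for the
remainder in the exponent. -/
def lgTerm₂ (ε α : ℝ → ℝ) (β lam : ℝ) (δ η : ℝ → ℝ) (t : ℝ) : ℝ :=
  (1 + δ t) / rFun ε α β lam t ^ (1 / 4 : ℝ) * (√(ε t) / √(α t + β * lam)) *
    Real.exp (∫ s in (0 : ℝ)..t,
      (-((α s + β * lam) / ε s) + lam / (α s + β * lam) +
        lam ^ 2 * ε s / (α s + β * lam) ^ 3 + η s))

/-- The error bounds
`|δ₁(t)| ≤ exp (½ ∫_0^t |φ|) - 1` and `|δ₂(t)| ≤ exp (½ ∫_t^∞ |φ|) - 1` for all `t ≥ 0`. -/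
def ErrorBounds (ε α : ℝ → ℝ) (β lam : ℝ) (δ₁ δ₂ : ℝ → ℝ) : Prop :=
  ∀ t : ℝ, 0 ≤ t →
    |δ₁ t| ≤ Real.exp (1 / 2 * ∫ s in (0 : ℝ)..t, |phiFun ε α β lam s|) - 1 ∧
    |δ₂ t| ≤ Real.exp (1 / 2 * ∫ s in Ioi t, |phiFun ε α β lam s|) - 1

end

/-! The mechanism is the Liouville-Green (WKB) method with explicit error control. Put `P =
exp(∫₀ᵗ(-p/2 + √r)) / r^(1/4)` and `q = exp(-2∫₀ᵗ√r)`, so that `P` and `P q` are the slow and fast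
approximate solutions. If `W = k₀ + k₁ q + ½∫₀ᵗ(1 - q(t)/q(s)) φ(s) W(s) ds`, then `x = P W` solves
(E) (`hasDerivWithinAt_liouvilleGreen`), and `k₀, k₁` can be fitted to any initial data. Solutions
of (E) are thus studied through an integral equation whose kernel is at most `½|φ|` in absolute
value.

Taking `k₀ = 1, k₁ = 0` gives `w₁`, normalised at `0`. Integrating from `t` to `∞` instead gives
`w₂`, normalised at `∞`; `q w₂` solves the same Volterra equation with constants `l₀, l₁`
(`exists_recessive`). Both error bounds are Gronwall estimates with weights `exp(½∫₀ᵗ|φ|)` and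
`exp(½∫ₜ^∞|φ|)`.

The delicate point is that `w₁` and `q w₂` may be proportional. This is possible only when `l₁ = 0`;
if `l₁ ≠ 0`, they span everything and the errors `w₁ - 1`, `w₂ - 1` serve for every solution. If `l₁
= 0`, then `q w₂ = l₀ w₁` with `l₀ ≠ 0`, and `φ` is not a.e. zero on `(0, ∞)`. The Gronwall
estimates discard a term that is then quantifiably positive, so a weighted sum of the two error
bounds has room at least `σ > 0`, uniformly in time (`exists_pos_le_slack`). Choose `A` large and
`B` with `A w₁ + B q w₂ = 0`; an arbitrary bounded `W` is then absorbed by moving the two errors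
within this room (`exists_error_terms`). Hence the errors in the representation may depend on the
solution.

Integrability of `φ` comes from writing `r = R/ε²`: `R` has a positive limit, and every term of `φ`
is an integrable factor times a bounded one (`phiFun_eq`). The expansion of the exponents rests on
an exact formula for the remainder divided by `ε`. -/

/-! ### Linear integral equations in a weighted sup norm. -/

/-- A priori bound for bounded solutions of a linear integral equation. -/
theorem abs_le_mul_of_integral_eq {μ : Measure ℝ} {κ : ℝ → ℝ → ℝ} {G E f W : ℝ → ℝ} {C N B : ℝ}
    (hmeas : ∀ t, AEStronglyMeasurable (κ t) μ) (hG : Integrable G μ)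
    (hdom : ∀ t s, |κ t s| ≤ G s) (hEc : Continuous E) (hE1 : ∀ t, 1 ≤ E t) (hEC : ∀ t, E t ≤ C)
    (hE : ∀ t, ∫ s, |κ t s| * E s ∂μ ≤ E t - 1) (hf : ∀ t, |f t| ≤ N)
    (hWB : ∀ t, |W t| ≤ B) (hW : ∀ t, W t = f t + ∫ s, κ t s * W s ∂μ) (t : ℝ) :
    |W t| ≤ N * E t := by
  have hN : 0 ≤ N := (abs_nonneg _).trans (hf 0)
  have hC : 0 < C := zero_lt_one.trans_le ((hE1 0).trans (hEC 0))
  have hint : ∀ t, Integrable (fun s => |κ t s| * E s) μ := fun t => by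
    refine (hG.mul_const C).mono' ((hmeas t).norm.mul hEc.aestronglyMeasurable)
      (Eventually.of_forall fun s => ?_)
    have := hE1 s
    rw [norm_mul, Real.norm_eq_abs, Real.norm_eq_abs, abs_abs, abs_of_nonneg (a := E s) (by linarith)]
    exact mul_le_mul (hdom t s) (hEC s) (by linarith) ((abs_nonneg _).trans (hdom t s))
  -- one step of the bootstrap
  have step : ∀ K, N ≤ K → (∀ t, |W t| ≤ K * E t) → ∀ t, |W t| ≤ (K - (K - N) / C) * E t := by
    intro K hNK hK t
    have hK0 : 0 ≤ K := hN.trans hNK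
    have h1 : |∫ s, κ t s * W s ∂μ| ≤ K * (E t - 1) := by
      calc |∫ s, κ t s * W s ∂μ| ≤ ∫ s, K * (|κ t s| * E s) ∂μ := by
            rw [← Real.norm_eq_abs]
            refine norm_integral_le_of_norm_le ((hint t).const_mul K)
              (Eventually.of_forall fun s => ?_)
            rw [norm_mul, Real.norm_eq_abs, Real.norm_eq_abs]
            calc |κ t s| * |W s| ≤ |κ t s| * (K * E s) := by gcongr; exact hK s
              _ = _ := by ring
        _ = K * ∫ s, |κ t s| * E s ∂μ := integral_const_mul _ _
        _ ≤ K * (E t - 1) := by gcongr; exact hE t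
    have h2 : |W t| ≤ N + K * (E t - 1) := by
      rw [hW t]
      exact (abs_add_le _ _).trans (add_le_add (hf t) h1)
    -- The gain `K - N` is a constant; since `E ≤ C` it becomes a multiple of `E`, so each pass
    -- shrinks the excess over `N` by the factor `1 - 1/C`.
    have h3 : (K - N) / C * E t ≤ K - N := by
      rw [div_mul_eq_mul_div, div_le_iff₀ hC]
      exact mul_le_mul_of_nonneg_left (hEC t) (by linarith)
    nlinarith
  have hB0 : 0 ≤ B := (abs_nonneg _).trans (hWB 0)
  -- iterate the bootstrap
  have hC1 : 1 ≤ C := (hE1 0).trans (hEC 0)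
  have iter : ∀ n : ℕ, ∀ t, |W t| ≤ (N + (1 - 1 / C) ^ n * B) * E t := by
    intro n
    induction n with
    | zero =>
      intro t
      have := hE1 t
      have := hWB t
      simp only [pow_zero, one_mul]
      nlinarith [mul_nonneg hN (by linarith : 0 ≤ E t)]
    | succ n ih =>
      intro t
      have hq : 0 ≤ 1 - 1 / C := by
        rw [sub_nonneg, div_le_one hC]; exact hC1
      have := step _ (by nlinarith [mul_nonneg (pow_nonneg hq n) hB0]) ih t
      refine this.trans (le_of_eq ?_)
      rw [pow_succ]
      ring
  have hlim : Tendsto (fun n : ℕ => (N + (1 - 1 / C) ^ n * B) * E t) atTop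
      (𝓝 ((N + 0 * B) * E t)) := by
    have h0 : Tendsto (fun n : ℕ => (1 - 1 / C) ^ n) atTop (𝓝 0) := by
      apply tendsto_pow_atTop_nhds_zero_of_lt_one
      · rw [sub_nonneg, div_le_one hC]; exact hC1
      · have : 0 < 1 / C := by positivity
        linarith
    exact ((h0.mul_const B).const_add N).mul_const _
  have := ge_of_tendsto' hlim fun n => iter n t
  simpa using this

/-- Existence for a linear integral equation whose kernel is dominated in a weighted norm. -/
theorem exists_integral_eq {μ : Measure ℝ} {κ : ℝ → ℝ → ℝ} {G E f : ℝ → ℝ} {C N : ℝ}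
    (hmeas : ∀ t, AEStronglyMeasurable (κ t) μ) (hG : Integrable G μ)
    (hdom : ∀ t s, |κ t s| ≤ G s) (hcont : ∀ s, Continuous fun t => κ t s)
    (hEc : Continuous E) (hE1 : ∀ t, 1 ≤ E t) (hEC : ∀ t, E t ≤ C)
    (hE : ∀ t, ∫ s, |κ t s| * E s ∂μ ≤ E t - 1) (hfc : Continuous f) (hf : ∀ t, |f t| ≤ N) :
    ∃ W : ℝ → ℝ, Continuous W ∧ (∀ t, W t = f t + ∫ s, κ t s * W s ∂μ) ∧
      ∀ t, |W t| ≤ N * E t := by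
  have hN : 0 ≤ N := (abs_nonneg _).trans (hf 0)
  have hC : 0 < C := zero_lt_one.trans_le ((hE1 0).trans (hEC 0))
  have hC1 : 1 ≤ C := (hE1 0).trans (hEC 0)
  have hEpos : ∀ t, 0 < E t := fun t => zero_lt_one.trans_le (hE1 t)
  have hint : ∀ (V : BoundedContinuousFunction ℝ ℝ) t,
      Integrable (fun s => κ t s * (E s * V s)) μ := fun V t => by
    refine ((hG.mul_const (C * ‖V‖))).mono'
      ((hmeas t).mul (hEc.mul V.continuous).aestronglyMeasurable) (Eventually.of_forall fun s => ?_)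
    rw [norm_mul, norm_mul, Real.norm_eq_abs, Real.norm_of_nonneg (hEpos s).le]
    exact mul_le_mul (hdom t s) (mul_le_mul (hEC s) (V.norm_coe_le_norm s) (norm_nonneg _) hC.le)
      (mul_nonneg (hEpos s).le (norm_nonneg _)) ((abs_nonneg _).trans (hdom t s))
  have hintE : ∀ t, Integrable (fun s => |κ t s| * E s) μ := fun t => by
    have := (hint (BoundedContinuousFunction.const ℝ 1) t).norm
    refine this.congr (Eventually.of_forall fun s => ?_)
    simp [abs_of_pos (hEpos s)]
  have hcontI : ∀ V : BoundedContinuousFunction ℝ ℝ,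
      Continuous fun t => ∫ s, κ t s * (E s * V s) ∂μ := fun V => by
    refine continuous_of_dominated (bound := fun s => G s * (C * ‖V‖)) (fun t => (hint V t).1)
      (fun t => Eventually.of_forall fun s => ?_) (hG.mul_const _)
      (Eventually.of_forall fun s => (hcont s).mul continuous_const)
    rw [norm_mul, norm_mul, Real.norm_eq_abs, Real.norm_of_nonneg (hEpos s).le]
    exact mul_le_mul (hdom t s) (mul_le_mul (hEC s) (V.norm_coe_le_norm s) (norm_nonneg _) hC.le)
      (mul_nonneg (hEpos s).le (norm_nonneg _)) ((abs_nonneg _).trans (hdom t s))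
  have hbd : ∀ (V : BoundedContinuousFunction ℝ ℝ) t,
      |∫ s, κ t s * (E s * V s) ∂μ| ≤ ‖V‖ * (E t - 1) := fun V t => by
    calc |∫ s, κ t s * (E s * V s) ∂μ| ≤ ∫ s, ‖V‖ * (|κ t s| * E s) ∂μ := by
          rw [← Real.norm_eq_abs]
          refine norm_integral_le_of_norm_le ((hintE t).const_mul _)
            (Eventually.of_forall fun s => ?_)
          rw [norm_mul, norm_mul, Real.norm_eq_abs, Real.norm_of_nonneg (hEpos s).le]
          calc |κ t s| * (E s * ‖V s‖) ≤ |κ t s| * (E s * ‖V‖) := by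
                have := V.norm_coe_le_norm s
                have := (hEpos s).le
                gcongr
            _ = _ := by ring
      _ = ‖V‖ * ∫ s, |κ t s| * E s ∂μ := integral_const_mul _ _
      _ ≤ _ := by gcongr; exact hE t
  -- Substituting `W = E V` turns the equation into a fixed point problem in the unweighted sup
  -- norm, with contraction factor `sup (E - 1)/E ≤ 1 - 1/C`.
  let F : BoundedContinuousFunction ℝ ℝ → BoundedContinuousFunction ℝ ℝ := fun V =>
    BoundedContinuousFunction.ofNormedAddCommGroup
      (fun t => (f t + ∫ s, κ t s * (E s * V s) ∂μ) / E t)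
      ((hfc.add (hcontI V)).div hEc fun t => (hEpos t).ne') (N + ‖V‖) (fun t => by
        rw [norm_div, Real.norm_eq_abs, Real.norm_of_nonneg (hEpos t).le, div_le_iff₀ (hEpos t)]
        have h1 := abs_add_le (f t) (∫ s, κ t s * (E s * V s) ∂μ)
        have h2 := hbd V t
        have h3 := hf t
        have h4 := hE1 t
        nlinarith [norm_nonneg V])
  have hFapp : ∀ V t, F V t = (f t + ∫ s, κ t s * (E s * V s) ∂μ) / E t := fun V t => rfl
  have hK0 : 0 ≤ 1 - 1 / C := by rw [sub_nonneg, div_le_one hC]; exact hC1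
  have hK1 : 1 - 1 / C < 1 := by
    have : 0 < 1 / C := by positivity
    linarith
  have hF : ContractingWith (1 - 1 / C).toNNReal F := by
    refine ⟨by rwa [Real.toNNReal_lt_one], LipschitzWith.of_dist_le_mul fun V V' => ?_⟩
    rw [BoundedContinuousFunction.dist_le (mul_nonneg (NNReal.coe_nonneg _) dist_nonneg)]
    intro t
    have hsub : F V t - F V' t = (∫ s, κ t s * (E s * (V - V') s) ∂μ) / E t := by
      rw [hFapp, hFapp, ← sub_div, add_sub_add_left_eq_sub, ← integral_sub (hint V t) (hint V' t)]
      congr 1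
      refine integral_congr_ae (Eventually.of_forall fun s => ?_)
      simp only [BoundedContinuousFunction.coe_sub, Pi.sub_apply]
      ring
    rw [Real.dist_eq, hsub, abs_div, abs_of_pos (hEpos t), div_le_iff₀ (hEpos t), dist_eq_norm]
    refine (hbd (V - V') t).trans ?_
    rw [Real.coe_toNNReal _ hK0]
    have h3 : 1 / C * E t ≤ 1 := by
      rw [one_div, inv_mul_le_iff₀ hC, mul_one]; exact hEC t
    nlinarith [norm_nonneg (V - V')]
  set V := hF.fixedPoint F with hV
  have hfix : ∀ t, E t * V t = f t + ∫ s, κ t s * (E s * V s) ∂μ := fun t => by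
    have h : F V t = V t := by rw [hV, hF.fixedPoint_isFixedPt.eq]
    rw [← h, hFapp, mul_div_cancel₀ _ (hEpos t).ne']
  refine ⟨fun t => E t * V t, hEc.mul V.continuous, hfix, fun t => ?_⟩
  refine abs_le_mul_of_integral_eq (B := C * ‖V‖) hmeas hG hdom hEc hE1 hEC hE hf (fun t => ?_) hfix t
  rw [abs_mul, abs_of_pos (hEpos t)]
  exact mul_le_mul (hEC t) (V.norm_coe_le_norm t) (abs_nonneg _) hC.le

/-! ### Kernels and Gronwall weights. -/

/-- The kernel of the integral equation normalised at `0`. -/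
noncomputable def forwardKernel (q φ : ℝ → ℝ) (t s : ℝ) : ℝ := 1 / 2 * (1 - min 1 (q t / q s)) * φ s

/-- The kernel of the integral equation normalised at `∞`. -/
noncomputable def backwardKernel (q φ : ℝ → ℝ) (t s : ℝ) : ℝ := 1 / 2 * (1 - min 1 (q s / q t)) * φ s

/-- `exp (½ ∫_0^t |φ|)`, constant for `t ≤ 0`. -/
noncomputable def forwardWeight (φ : ℝ → ℝ) (t : ℝ) : ℝ :=
  Real.exp (1 / 2 * ∫ s in (0 : ℝ)..max t 0, |φ s|)

/-- `exp (½ ∫_t^∞ |φ|)`, constant for `t ≤ 0`. -/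
noncomputable def backwardWeight (φ : ℝ → ℝ) (t : ℝ) : ℝ :=
  Real.exp (1 / 2 * ∫ s in Ioi (max t 0), |φ s|)

section Kernels

variable {q φ W : ℝ → ℝ}

theorem abs_forwardKernel (t s : ℝ) :
    |forwardKernel q φ t s| = forwardKernel q (fun s => |φ s|) t s := by
  have : 0 ≤ 1 / 2 * (1 - min 1 (q t / q s)) := by
    have := min_le_left 1 (q t / q s)
    linarith
  rw [forwardKernel, forwardKernel, abs_mul, abs_of_nonneg this]

theorem abs_backwardKernel (t s : ℝ) :
    |backwardKernel q φ t s| = backwardKernel q (fun s => |φ s|) t s := by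
  have : 0 ≤ 1 / 2 * (1 - min 1 (q s / q t)) := by
    have := min_le_left 1 (q s / q t)
    linarith
  rw [backwardKernel, backwardKernel, abs_mul, abs_of_nonneg this]

theorem abs_forwardKernel_le (hq : ∀ t, 0 < q t) (t s : ℝ) : |forwardKernel q φ t s| ≤ |φ s| := by
  rw [abs_forwardKernel, forwardKernel]
  have h0 : 0 ≤ min 1 (q t / q s) := le_min zero_le_one (div_pos (hq t) (hq s)).le
  have := abs_nonneg (φ s)
  nlinarith [mul_nonneg h0 this]

theorem abs_backwardKernel_le (hq : ∀ t, 0 < q t) (t s : ℝ) :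
    |backwardKernel q φ t s| ≤ |φ s| := by
  rw [abs_backwardKernel, backwardKernel]
  have h0 : 0 ≤ min 1 (q s / q t) := le_min zero_le_one (div_pos (hq s) (hq t)).le
  have := abs_nonneg (φ s)
  nlinarith [mul_nonneg h0 this]

theorem continuous_forwardKernel_left (hqc : Continuous q) (s : ℝ) :
    Continuous fun t => forwardKernel q φ t s := by
  unfold forwardKernel
  fun_prop

theorem continuous_forwardKernel_right (hqc : Continuous q) (hq : ∀ t, 0 < q t)
    (hφ : Continuous φ) (t : ℝ) : Continuous (forwardKernel q φ t) := by
  unfold forwardKernel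
  have : Continuous fun s => q t / q s := continuous_const.div hqc fun s => (hq s).ne'
  fun_prop

theorem continuous_backwardKernel_left (hqc : Continuous q) (hq : ∀ t, 0 < q t) (s : ℝ) :
    Continuous fun t => backwardKernel q φ t s := by
  unfold backwardKernel
  have : Continuous fun t => q s / q t := continuous_const.div hqc fun s => (hq s).ne'
  fun_prop

theorem continuous_backwardKernel_right (hqc : Continuous q)
    (hφ : Continuous φ) (t : ℝ) : Continuous (backwardKernel q φ t) := by
  unfold backwardKernel
  fun_prop

/-- Since `q` decreases, the `min` makes the kernel vanish for `s ≥ t`. The Volterra integral is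
therefore an integral over the fixed domain `(0, ∞)`, with a kernel continuous in `t`, as the
abstract lemmas require. -/
theorem integral_forwardKernel_mul (hqc : Continuous q) (hq : ∀ t, 0 < q t) (hqa : Antitone q)
    (hφ : Continuous φ) (hW : Continuous W) {t : ℝ} (ht : 0 ≤ t) :
    ∫ s in Ioi 0, forwardKernel q φ t s * W s =
      1 / 2 * (∫ s in (0 : ℝ)..t, φ s * W s) -
        1 / 2 * q t * ∫ s in (0 : ℝ)..t, φ s * W s / q s := by
  have h1 : ∫ s in Ioi 0, forwardKernel q φ t s * W s =
      ∫ s in Ioc 0 t, forwardKernel q φ t s * W s := by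
    refine setIntegral_eq_of_subset_of_forall_sdiff_eq_zero measurableSet_Ioi Ioc_subset_Ioi_self
      fun s hs => ?_
    have hts : t ≤ s := by
      by_contra! h
      exact hs.2 ⟨hs.1, h.le⟩
    rw [forwardKernel, min_eq_left]
    · simp
    · rw [le_div_iff₀ (hq s), one_mul]; exact hqa hts
  have hdiv : Continuous fun s => φ s * W s / q s := (hφ.mul hW).div hqc fun s => (hq s).ne'
  have hmul : Continuous fun s => φ s * W s := hφ.mul hW
  rw [h1, ← intervalIntegral.integral_of_le ht, ← intervalIntegral.integral_const_mul,
    ← intervalIntegral.integral_const_mul, ← intervalIntegral.integral_sub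
      ((hmul.intervalIntegrable _ _).const_mul _)
      ((hdiv.intervalIntegrable _ _).const_mul _)]
  refine intervalIntegral.integral_congr fun s hs => ?_
  rw [uIcc_of_le ht] at hs
  have : q t / q s ≤ 1 := by
    rw [div_le_one (hq s)]; exact hqa hs.2
  simp only [forwardKernel, min_eq_right this]
  have := (hq s).ne'
  field_simp

theorem integrableOn_mul_of_bounded {B : ℝ} {f g : ℝ → ℝ} {S : Set ℝ} (hf : IntegrableOn f S)
    (hg : Continuous g) (hB : ∀ t, |g t| ≤ B) : IntegrableOn (fun s => f s * g s) S :=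
  Integrable.mul_bdd (c := B) hf hg.aestronglyMeasurable (Eventually.of_forall hB)

/-- Here the `min` kills `s ≤ t`, leaving the integral over `(t, ∞)`. -/
theorem integral_backwardKernel_mul {B : ℝ} (hqc : Continuous q) (hq : ∀ t, 0 < q t)
    (hq1 : ∀ t, q t ≤ 1) (hqa : Antitone q)
    (hφi : IntegrableOn φ (Ioi 0)) (hW : Continuous W) (hB : ∀ t, |W t| ≤ B)
    {t : ℝ} (ht : 0 ≤ t) :
    ∫ s in Ioi 0, backwardKernel q φ t s * W s =
      1 / 2 * (∫ s in Ioi t, φ s * W s) -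
        1 / 2 / q t * ∫ s in Ioi t, φ s * W s * q s := by
  have h1 : ∫ s in Ioi 0, backwardKernel q φ t s * W s =
      ∫ s in Ioi t, backwardKernel q φ t s * W s := by
    refine setIntegral_eq_of_subset_of_forall_sdiff_eq_zero measurableSet_Ioi (Ioi_subset_Ioi ht)
      fun s hs => ?_
    have hts : s ≤ t := not_lt.1 hs.2
    rw [backwardKernel, min_eq_left]
    · simp
    · rw [le_div_iff₀ (hq t), one_mul]; exact hqa hts
  have hi : IntegrableOn (fun s => φ s * W s) (Ioi t) :=
    integrableOn_mul_of_bounded (hφi.mono_set (Ioi_subset_Ioi ht)) hW hB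
  have hi' : IntegrableOn (fun s => φ s * W s * q s) (Ioi t) :=
    integrableOn_mul_of_bounded hi hqc fun t => by rw [abs_of_pos (hq t)]; exact hq1 t
  rw [h1, ← integral_const_mul, ← integral_const_mul,
    ← integral_sub (hi.const_mul _) (hi'.const_mul _)]
  refine setIntegral_congr_fun measurableSet_Ioi fun s hs => ?_
  have : q s / q t ≤ 1 := by
    rw [div_le_one (hq t)]; exact hqa (le_of_lt hs)
  simp only [backwardKernel, min_eq_right this]
  have := (hq t).ne'
  field_simp

theorem continuous_primitive_max (hφ : Continuous φ) :
    Continuous fun t => ∫ s in (0 : ℝ)..max t 0, φ s :=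
  (intervalIntegral.continuous_primitive (fun a b => hφ.intervalIntegrable a b) 0).comp
    (continuous_id.max continuous_const)

theorem integral_add_integral_Ioi (hφ : Continuous φ)
    (hφi : IntegrableOn φ (Ioi 0)) (t : ℝ) :
    (∫ s in (0 : ℝ)..t, φ s) + ∫ s in Ioi t, φ s = ∫ s in Ioi 0, φ s := by
  have hti : IntegrableOn φ (Ioi t) := by
    rcases le_total 0 t with h | h
    · exact hφi.mono_set (Ioi_subset_Ioi h)
    · rw [← Ioc_union_Ioi_eq_Ioi h]
      exact (hφ.integrableOn_Ioc).union hφi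
  exact intervalIntegral.integral_interval_add_Ioi' (hφ.intervalIntegrable _ _) hti

theorem forwardWeight_mul_backwardWeight (hφ : Continuous φ) (hφi : IntegrableOn φ (Ioi 0))
    (t : ℝ) : forwardWeight φ t * backwardWeight φ t =
      Real.exp (1 / 2 * ∫ s in Ioi 0, |φ s|) := by
  rw [forwardWeight, backwardWeight, ← Real.exp_add, ← mul_add,
    integral_add_integral_Ioi hφ.abs hφi.abs]

theorem one_le_forwardWeight (t : ℝ) : 1 ≤ forwardWeight φ t := by
  refine Real.one_le_exp (mul_nonneg (by norm_num) ?_)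
  exact intervalIntegral.integral_nonneg (le_max_right _ _) fun _ _ => abs_nonneg _

theorem one_le_backwardWeight (t : ℝ) : 1 ≤ backwardWeight φ t := by
  refine Real.one_le_exp (mul_nonneg (by norm_num) ?_)
  exact integral_nonneg fun _ => abs_nonneg _

theorem forwardWeight_le (hφ : Continuous φ) (hφi : IntegrableOn φ (Ioi 0)) (t : ℝ) :
    forwardWeight φ t ≤ Real.exp (1 / 2 * ∫ s in Ioi 0, |φ s|) := by
  rw [← forwardWeight_mul_backwardWeight hφ hφi t]
  nlinarith [one_le_forwardWeight (φ := φ) t, one_le_backwardWeight (φ := φ) t]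

theorem backwardWeight_le (hφ : Continuous φ) (hφi : IntegrableOn φ (Ioi 0)) (t : ℝ) :
    backwardWeight φ t ≤ Real.exp (1 / 2 * ∫ s in Ioi 0, |φ s|) := by
  rw [← forwardWeight_mul_backwardWeight hφ hφi t]
  nlinarith [one_le_forwardWeight (φ := φ) t, one_le_backwardWeight (φ := φ) t]

theorem continuous_forwardWeight (hφ : Continuous φ) : Continuous (forwardWeight φ) :=
  Real.continuous_exp.comp (continuous_const.mul (continuous_primitive_max hφ.abs))

/-- Reduces continuity, differentiation and the limit of the backward weight to those of the forward
one. -/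
theorem backwardWeight_eq (hφ : Continuous φ) (hφi : IntegrableOn φ (Ioi 0)) (t : ℝ) :
    backwardWeight φ t = Real.exp (1 / 2 * ∫ s in Ioi 0, |φ s|) / forwardWeight φ t := by
  rw [← forwardWeight_mul_backwardWeight hφ hφi t]
  field_simp [(zero_lt_one.trans_le (one_le_forwardWeight (φ := φ) t)).ne']

theorem continuous_backwardWeight (hφ : Continuous φ) (hφi : IntegrableOn φ (Ioi 0)) :
    Continuous (backwardWeight φ) := by
  rw [funext (backwardWeight_eq hφ hφi)]
  exact continuous_const.div (continuous_forwardWeight hφ)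
    fun t => (zero_lt_one.trans_le (one_le_forwardWeight t)).ne'

theorem hasDerivAt_forwardWeight (hφ : Continuous φ) {t : ℝ} (ht : 0 < t) :
    HasDerivAt (forwardWeight φ) (1 / 2 * (|φ t| * forwardWeight φ t)) t := by
  have h : HasDerivAt (fun t => Real.exp (1 / 2 * ∫ s in (0 : ℝ)..t, |φ s|))
      (Real.exp (1 / 2 * ∫ s in (0 : ℝ)..t, |φ s|) * (1 / 2 * |φ t|)) t :=
    ((intervalIntegral.integral_hasDerivAt_right (hφ.abs.intervalIntegrable _ _)
      (hφ.abs.stronglyMeasurableAtFilter _ _) hφ.abs.continuousAt).const_mul _).exp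
  have he : forwardWeight φ =ᶠ[𝓝 t] fun t => Real.exp (1 / 2 * ∫ s in (0 : ℝ)..t, |φ s|) := by
    filter_upwards [lt_mem_nhds ht] with s hs
    rw [forwardWeight, max_eq_left (le_of_lt hs)]
  refine (h.congr_of_eventuallyEq he).congr_deriv ?_
  rw [forwardWeight, max_eq_left ht.le]
  ring

/-- The weight `E` satisfies `E' = ½|φ|E` and `E(0) = 1`: it is the equality case of Gronwall. -/
theorem integral_abs_mul_forwardWeight (hφ : Continuous φ) {t : ℝ} (ht : 0 ≤ t) :
    1 / 2 * ∫ s in (0 : ℝ)..t, |φ s| * forwardWeight φ s = forwardWeight φ t - 1 := by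
  have h0 : forwardWeight φ 0 = 1 := by simp [forwardWeight]
  rw [← intervalIntegral.integral_const_mul]
  nth_rw 2 [← h0]
  refine intervalIntegral.integral_eq_sub_of_hasDerivAt_of_le ht
    (continuous_forwardWeight hφ).continuousOn
    (fun x hx => hasDerivAt_forwardWeight hφ hx.1) ?_
  exact (continuous_const.mul (hφ.abs.mul (continuous_forwardWeight hφ))).intervalIntegrable _ _

/-- The same identity run from infinity, where the backward weight tends to `1`. -/
theorem integral_abs_mul_backwardWeight (hφ : Continuous φ) (hφi : IntegrableOn φ (Ioi 0))
    {t : ℝ} (ht : 0 ≤ t) :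
    1 / 2 * ∫ s in Ioi t, |φ s| * backwardWeight φ s = backwardWeight φ t - 1 := by
  have hpos : ∀ t, 0 < forwardWeight φ t := fun t => zero_lt_one.trans_le (one_le_forwardWeight t)
  have hd : ∀ s ∈ Ioi t, HasDerivAt (fun s => -backwardWeight φ s)
      (1 / 2 * (|φ s| * backwardWeight φ s)) s := fun s hs => by
    rw [funext (backwardWeight_eq hφ hφi)]
    have := ((hasDerivAt_const s (Real.exp (1 / 2 * ∫ s in Ioi 0, |φ s|))).div
      (hasDerivAt_forwardWeight hφ (ht.trans_lt hs)) (hpos s).ne').neg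
    refine this.congr_deriv ?_
    have := (hpos s).ne'
    field_simp
    ring
  have hlim : Tendsto (fun s => -backwardWeight φ s) atTop (𝓝 (-1)) := by
    refine Tendsto.neg ?_
    have hF : Tendsto (forwardWeight φ) atTop (𝓝 (Real.exp (1 / 2 * ∫ s in Ioi 0, |φ s|))) := by
      refine (Real.continuous_exp.tendsto _).comp (Tendsto.const_mul _ ?_)
      refine (intervalIntegral_tendsto_integral_Ioi 0 hφi.abs tendsto_id).congr' ?_
      filter_upwards [eventually_ge_atTop 0] with s hs
      rw [max_eq_left hs, id]
    have := (tendsto_const_nhds (x := Real.exp (1 / 2 * ∫ s in Ioi 0, |φ s|))).div hF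
      (Real.exp_ne_zero _)
    rw [div_self (Real.exp_ne_zero _)] at this
    exact this.congr fun s => (backwardWeight_eq hφ hφi s).symm
  have hb := integrableOn_mul_of_bounded (hφi.mono_set (Ioi_subset_Ioi ht)).abs
    (continuous_backwardWeight hφ hφi) (fun s => by
      rw [abs_of_pos (zero_lt_one.trans_le (one_le_backwardWeight s))]
      exact backwardWeight_le hφ hφi s)
  have := integral_Ioi_of_hasDerivAt_of_tendsto
    (continuous_backwardWeight hφ hφi).neg.continuousWithinAt hd (hb.const_mul _) hlim
  rw [integral_const_mul] at this
  rw [this]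
  simp only [Pi.neg_apply]
  ring

/-- The subtracted term is kept exactly: dropping it gives the contraction hypothesis, and keeping
it gives the room needed when the two solutions are proportional. -/
theorem integral_abs_forwardKernel_mul (hqc : Continuous q) (hq : ∀ t, 0 < q t) (hqa : Antitone q)
    (hφ : Continuous φ) {t : ℝ} (ht : 0 ≤ t) :
    ∫ s in Ioi 0, |forwardKernel q φ t s| * forwardWeight φ s =
      forwardWeight φ t - 1 -
        1 / 2 * q t * ∫ s in (0 : ℝ)..t, |φ s| * forwardWeight φ s / q s := by
  simp only [abs_forwardKernel]
  rw [integral_forwardKernel_mul hqc hq hqa hφ.abs (continuous_forwardWeight hφ) ht,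
    integral_abs_mul_forwardWeight hφ ht]

theorem integral_abs_backwardKernel_mul (hqc : Continuous q) (hq : ∀ t, 0 < q t)
    (hq1 : ∀ t, q t ≤ 1) (hqa : Antitone q)
    (hφ : Continuous φ) (hφi : IntegrableOn φ (Ioi 0)) {t : ℝ} (ht : 0 ≤ t) :
    ∫ s in Ioi 0, |backwardKernel q φ t s| * backwardWeight φ s =
      backwardWeight φ t - 1 -
        1 / 2 / q t * ∫ s in Ioi t, |φ s| * backwardWeight φ s * q s := by
  simp only [abs_backwardKernel]
  rw [integral_backwardKernel_mul hqc hq hq1 hqa hφi.abs (continuous_backwardWeight hφ hφi)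
    (fun s => by
      rw [abs_of_pos (zero_lt_one.trans_le (one_le_backwardWeight s))]
      exact backwardWeight_le hφ hφi s) ht, integral_abs_mul_backwardWeight hφ hφi ht]

end Kernels

/-! ### The Volterra equation and its two normalised solutions. -/

/-- `W` solves the Volterra equation
`W = k₀ + k₁ q + ½ ∫_0^t (1 - q(t) / q(s)) φ(s) W(s) ds` on `[0, ∞)`. -/
def VolterraEq (q φ : ℝ → ℝ) (k₀ k₁ : ℝ) (W : ℝ → ℝ) : Prop :=
  ∀ t, 0 ≤ t → W t = k₀ + k₁ * q t +
    (1 / 2 * (∫ s in (0 : ℝ)..t, φ s * W s) - 1 / 2 * q t * ∫ s in (0 : ℝ)..t, φ s * W s / q s)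

section Volterra

variable {q φ W : ℝ → ℝ}

theorem VolterraEq.lincomb {W₁ W₂ : ℝ → ℝ} {k₀ k₁ l₀ l₁ : ℝ} (hqc : Continuous q)
    (hq : ∀ t, 0 < q t) (hφ : Continuous φ) (hc₁ : Continuous W₁) (hc₂ : Continuous W₂)
    (h₁ : VolterraEq q φ k₀ k₁ W₁) (h₂ : VolterraEq q φ l₀ l₁ W₂) (a b : ℝ) :
    VolterraEq q φ (a * k₀ + b * l₀) (a * k₁ + b * l₁) fun t => a * W₁ t + b * W₂ t := by
  intro t ht
  have hd : ∀ V : ℝ → ℝ, Continuous V → Continuous fun s => φ s * V s / q s := fun V hV =>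
    (hφ.mul hV).div hqc fun s => (hq s).ne'
  have hm : ∀ V : ℝ → ℝ, Continuous V → Continuous fun s => φ s * V s := fun V hV => hφ.mul hV
  have e1 : ∫ s in (0 : ℝ)..t, φ s * (a * W₁ s + b * W₂ s) =
      a * (∫ s in (0 : ℝ)..t, φ s * W₁ s) + b * ∫ s in (0 : ℝ)..t, φ s * W₂ s := by
    rw [← intervalIntegral.integral_const_mul, ← intervalIntegral.integral_const_mul,
      ← intervalIntegral.integral_add (((hm _ hc₁).intervalIntegrable _ _).const_mul _)
      (((hm _ hc₂).intervalIntegrable _ _).const_mul _)]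
    refine intervalIntegral.integral_congr fun s _ => ?_
    ring
  have e2 : ∫ s in (0 : ℝ)..t, φ s * (a * W₁ s + b * W₂ s) / q s =
      a * (∫ s in (0 : ℝ)..t, φ s * W₁ s / q s) + b * ∫ s in (0 : ℝ)..t, φ s * W₂ s / q s := by
    rw [← intervalIntegral.integral_const_mul, ← intervalIntegral.integral_const_mul,
      ← intervalIntegral.integral_add (((hd _ hc₁).intervalIntegrable _ _).const_mul _)
      (((hd _ hc₂).intervalIntegrable _ _).const_mul _)]
    refine intervalIntegral.integral_congr fun s _ => ?_
    ring
  simp only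
  rw [e1, e2, h₁ t ht, h₂ t ht]
  ring

theorem forwardKernel_max (hqm : ∀ t, q (max t 0) = q t) (t s : ℝ) :
    forwardKernel q φ (max t 0) s = forwardKernel q φ t s := by
  rw [forwardKernel, hqm, forwardKernel]

theorem backwardKernel_max (hqm : ∀ t, q (max t 0) = q t) (t s : ℝ) :
    backwardKernel q φ (max t 0) s = backwardKernel q φ t s := by
  rw [backwardKernel, hqm, backwardKernel]

theorem forwardWeight_max (t : ℝ) : forwardWeight φ (max t 0) = forwardWeight φ t := by
  rw [forwardWeight, forwardWeight, max_eq_left (le_max_right _ _)]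

theorem backwardWeight_max (t : ℝ) : backwardWeight φ (max t 0) = backwardWeight φ t := by
  rw [backwardWeight, backwardWeight, max_eq_left (le_max_right _ _)]

theorem integral_abs_forwardKernel_mul_le (hqc : Continuous q) (hq : ∀ t, 0 < q t)
    (hqa : Antitone q) (hqm : ∀ t, q (max t 0) = q t) (hφ : Continuous φ) (t : ℝ) :
    ∫ s in Ioi 0, |forwardKernel q φ t s| * forwardWeight φ s ≤ forwardWeight φ t - 1 := by
  have h := integral_abs_forwardKernel_mul hqc hq hqa hφ (le_max_right t 0)
  simp only [forwardKernel_max hqm, forwardWeight_max] at h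
  rw [h, sub_le_self_iff]
  have := hq (max t 0)
  refine mul_nonneg (by positivity) (intervalIntegral.integral_nonneg (le_max_right _ _) fun s _ => ?_)
  have := one_le_forwardWeight (φ := φ) s
  have := hq s
  positivity

theorem integral_abs_backwardKernel_mul_le (hqc : Continuous q) (hq : ∀ t, 0 < q t)
    (hq1 : ∀ t, q t ≤ 1) (hqa : Antitone q) (hqm : ∀ t, q (max t 0) = q t) (hφ : Continuous φ)
    (hφi : IntegrableOn φ (Ioi 0)) (t : ℝ) :
    ∫ s in Ioi 0, |backwardKernel q φ t s| * backwardWeight φ s ≤ backwardWeight φ t - 1 := by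
  have h := integral_abs_backwardKernel_mul hqc hq hq1 hqa hφ hφi (le_max_right t 0)
  simp only [backwardKernel_max hqm, backwardWeight_max] at h
  rw [h, sub_le_self_iff]
  have := hq (max t 0)
  refine mul_nonneg (by positivity) (integral_nonneg fun s => ?_)
  have := one_le_backwardWeight (φ := φ) s
  have := hq s
  positivity

theorem exists_volterraEq (hqc : Continuous q) (hq : ∀ t, 0 < q t) (hq1 : ∀ t, q t ≤ 1)
    (hqa : Antitone q) (hqm : ∀ t, q (max t 0) = q t) (hφ : Continuous φ)
    (hφi : IntegrableOn φ (Ioi 0)) (k₀ k₁ : ℝ) :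
    ∃ W, Continuous W ∧ VolterraEq q φ k₀ k₁ W ∧
      ∀ t, |W t| ≤ (|k₀| + |k₁|) * forwardWeight φ t := by
  obtain ⟨W, hWc, hW, hWb⟩ := exists_integral_eq (μ := volume.restrict (Ioi 0))
    (κ := forwardKernel q φ) (G := fun s => |φ s|) (E := forwardWeight φ)
    (f := fun t => k₀ + k₁ * q t) (N := |k₀| + |k₁|)
    (fun t => (continuous_forwardKernel_right hqc hq hφ t).aestronglyMeasurable) hφi.abs
    (abs_forwardKernel_le hq) (continuous_forwardKernel_left hqc) (continuous_forwardWeight hφ)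
    one_le_forwardWeight (forwardWeight_le hφ hφi)
    (integral_abs_forwardKernel_mul_le hqc hq hqa hqm hφ) (by fun_prop) (fun t => by
      refine (abs_add_le _ _).trans (add_le_add_right ?_ _)
      rw [abs_mul, abs_of_pos (hq t)]
      exact mul_le_of_le_one_right (abs_nonneg _) (hq1 t))
  refine ⟨W, hWc, fun t ht => ?_, hWb⟩
  rw [← integral_forwardKernel_mul hqc hq hqa hφ hWc ht]
  exact hW t

/-- This is the a priori bound with zero forcing, `N = 0`. `W` is replaced by `W (max t 0)` because
the bound concerns functions on the whole line. -/
theorem VolterraEq.eq_zero (hqc : Continuous q) (hq : ∀ t, 0 < q t)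
    (hqa : Antitone q) (hqm : ∀ t, q (max t 0) = q t) (hφ : Continuous φ)
    (hφi : IntegrableOn φ (Ioi 0)) (hWc : Continuous W) {B : ℝ} (hWB : ∀ t, 0 ≤ t → |W t| ≤ B)
    (hW : VolterraEq q φ 0 0 W) {t : ℝ} (ht : 0 ≤ t) : W t = 0 := by
  have hV : ∀ t, W (max t 0) = 0 + ∫ s in Ioi 0, forwardKernel q φ t s * W (max s 0) := by
    intro t
    have h1 := hW (max t 0) (le_max_right _ _)
    rw [← integral_forwardKernel_mul hqc hq hqa hφ hWc (le_max_right _ _)] at h1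
    simp only [forwardKernel_max hqm] at h1
    rw [h1]
    simp only [zero_mul, zero_add]
    refine setIntegral_congr_fun measurableSet_Ioi fun s hs => ?_
    rw [max_eq_left (le_of_lt hs)]
  have := abs_le_mul_of_integral_eq (μ := volume.restrict (Ioi 0))
    (κ := forwardKernel q φ) (G := fun s => |φ s|) (E := forwardWeight φ)
    (f := fun _ => 0) (N := 0) (W := fun t => W (max t 0)) (B := B)
    (fun t => (continuous_forwardKernel_right hqc hq hφ t).aestronglyMeasurable) hφi.abs
    (abs_forwardKernel_le hq) (continuous_forwardWeight hφ)
    one_le_forwardWeight (forwardWeight_le hφ hφi)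
    (integral_abs_forwardKernel_mul_le hqc hq hqa hqm hφ) (by simp)
    (fun t => hWB _ (le_max_right _ _)) hV t
  rw [max_eq_left ht, zero_mul] at this
  exact abs_nonpos_iff.1 this

/-- The solution normalised at `∞`. -/
theorem exists_recessive (hqc : Continuous q) (hq : ∀ t, 0 < q t) (hq1 : ∀ t, q t ≤ 1)
    (hqa : Antitone q) (hqm : ∀ t, q (max t 0) = q t) (hφ : Continuous φ)
    (hφi : IntegrableOn φ (Ioi 0)) :
    ∃ w, Continuous w ∧ (∀ t, |w t| ≤ backwardWeight φ t) ∧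
      VolterraEq q φ (-(1 / 2 * ∫ s in Ioi 0, φ s * w s * q s))
        (1 + 1 / 2 * ∫ s in Ioi 0, φ s * w s) (fun t => q t * w t) ∧
      ∀ t, 0 ≤ t → |w t - 1| ≤ backwardWeight φ t - 1 -
        1 / 2 / q t * ∫ s in Ioi t, |φ s| * backwardWeight φ s * q s := by
  obtain ⟨W, hWc, hW, hWb⟩ := exists_integral_eq (μ := volume.restrict (Ioi 0))
    (κ := backwardKernel q φ) (G := fun s => |φ s|) (E := backwardWeight φ)
    (f := fun t => 1) (N := 1)
    (fun t => (continuous_backwardKernel_right hqc hφ t).aestronglyMeasurable) hφi.abs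
    (abs_backwardKernel_le hq) (continuous_backwardKernel_left hqc hq)
    (continuous_backwardWeight hφ hφi)
    one_le_backwardWeight (backwardWeight_le hφ hφi)
    (integral_abs_backwardKernel_mul_le hqc hq hq1 hqa hqm hφ hφi) (by fun_prop) (by simp)
  simp only [one_mul] at hWb
  have hB : ∀ t, |W t| ≤ Real.exp (1 / 2 * ∫ s in Ioi 0, |φ s|) := fun t =>
    (hWb t).trans (backwardWeight_le hφ hφi t)
  refine ⟨W, hWc, hWb, fun t ht => ?_, fun t ht => ?_⟩
  · have hi := integrableOn_mul_of_bounded hφi hWc hB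
    have hi' : IntegrableOn (fun s => φ s * W s * q s) (Ioi 0) :=
      integrableOn_mul_of_bounded hi hqc fun t => by rw [abs_of_pos (hq t)]; exact hq1 t
    have h1 := hW t
    rw [integral_backwardKernel_mul hqc hq hq1 hqa hφi hWc hB ht] at h1
    -- Multiplying the backward equation by `q` and replacing each `∫ₜ^∞` by `∫₀^∞ - ∫₀ᵗ` yields the
    -- forward equation; the two full integrals become its constants.
    have e1 := integral_add_integral_Ioi (hφ.mul hWc) hi t
    have e2 := integral_add_integral_Ioi ((hφ.mul hWc).mul hqc) hi' t
    have c1 : ∫ s in (0 : ℝ)..t, φ s * (q s * W s) = ∫ s in (0 : ℝ)..t, φ s * W s * q s :=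
      intervalIntegral.integral_congr fun s _ => by ring
    have c2 : ∫ s in (0 : ℝ)..t, φ s * (q s * W s) / q s = ∫ s in (0 : ℝ)..t, φ s * W s :=
      intervalIntegral.integral_congr fun s _ => by
        have := (hq s).ne'
        field_simp
    have hqt := (hq t).ne'
    simp only [c1, c2, h1, Pi.mul_apply] at e1 e2 ⊢
    rw [← e1, ← e2]
    field_simp
    ring
  · rw [← integral_abs_backwardKernel_mul hqc hq hq1 hqa hφ hφi ht]
    have h1 : W t - 1 = ∫ s in Ioi 0, backwardKernel q φ t s * W s := by
      rw [hW t]; ring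
    rw [h1, ← Real.norm_eq_abs]
    refine norm_integral_le_of_norm_le ?_ (Eventually.of_forall fun s => ?_)
    · refine integrableOn_mul_of_bounded (B := Real.exp (1 / 2 * ∫ s in Ioi 0, |φ s|))
        ?_ (continuous_backwardWeight hφ hφi) fun s => ?_
      · exact hφi.abs.mono' (continuous_backwardKernel_right hqc hφ t).abs.aestronglyMeasurable
          (Eventually.of_forall fun s => by
            rw [Real.norm_eq_abs, abs_abs]; exact abs_backwardKernel_le hq t s)
      · rw [abs_of_pos (zero_lt_one.trans_le (one_le_backwardWeight s))]
        exact backwardWeight_le hφ hφi s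
    · rw [norm_mul]
      exact mul_le_mul_of_nonneg_left (hWb s) (norm_nonneg _)

/-- Both bounds come from one estimate with a majorant `V` of `|W|`: `V = E` keeps the discarded
kernel term, while `V = |W|` lets a pointwise gap between `|W|` and `E` be fed back in. -/
theorem VolterraEq.abs_sub_one_le (hqc : Continuous q) (hq : ∀ t, 0 < q t)
    (hqa : Antitone q) (hφ : Continuous φ) (hWc : Continuous W)
    (hWb : ∀ t, |W t| ≤ forwardWeight φ t) (hW : VolterraEq q φ 1 0 W) {t : ℝ} (ht : 0 ≤ t) :
    |W t - 1| ≤ forwardWeight φ t - 1 -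
        1 / 2 * q t * ∫ s in (0 : ℝ)..t, |φ s| * forwardWeight φ s / q s ∧
    |W t - 1| ≤ 1 / 2 * ∫ s in (0 : ℝ)..t, |φ s| * |W s| := by
  have h1 : W t - 1 = 1 / 2 * (∫ s in (0 : ℝ)..t, φ s * W s) -
      1 / 2 * q t * ∫ s in (0 : ℝ)..t, φ s * W s / q s := by
    rw [hW t ht]; ring
  have hd : ∀ V : ℝ → ℝ, Continuous V → Continuous fun s => |φ s| * V s / q s := fun V hV =>
    (hφ.abs.mul hV).div hqc fun s => (hq s).ne'
  have hd' : Continuous fun s => φ s * W s / q s := (hφ.mul hWc).div hqc fun s => (hq s).ne'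
  have hm : Continuous fun s => φ s * W s := hφ.mul hWc
  have hm' : ∀ V : ℝ → ℝ, Continuous V → Continuous fun s => |φ s| * V s := fun V hV =>
    hφ.abs.mul hV
  have key : ∀ V : ℝ → ℝ, Continuous V → (∀ t, |W t| ≤ V t) → |W t - 1| ≤
      1 / 2 * (∫ s in (0 : ℝ)..t, |φ s| * V s) -
        1 / 2 * q t * ∫ s in (0 : ℝ)..t, |φ s| * V s / q s := by
    intro V hV hWV
    rw [h1, ← intervalIntegral.integral_const_mul, ← intervalIntegral.integral_const_mul,
      ← intervalIntegral.integral_sub ((hm.intervalIntegrable _ _).const_mul _)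
      ((hd'.intervalIntegrable _ _).const_mul _), ← intervalIntegral.integral_const_mul,
      ← intervalIntegral.integral_const_mul,
      ← intervalIntegral.integral_sub (((hm' V hV).intervalIntegrable _ _).const_mul _)
      (((hd V hV).intervalIntegrable _ _).const_mul _), ← Real.norm_eq_abs]
    refine intervalIntegral.norm_integral_le_of_norm_le ht (Eventually.of_forall fun s hs => ?_)
      ((((hm' V hV).intervalIntegrable _ _).const_mul _).sub
        (((hd V hV).intervalIntegrable _ _).const_mul _))
    have hqs := hq s
    have h2 : 0 ≤ 1 / 2 * (1 - q t / q s) := by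
      have : q t / q s ≤ 1 := by
        rw [div_le_one hqs]; exact hqa hs.2
      linarith
    have e1 : 1 / 2 * (φ s * W s) - 1 / 2 * q t * (φ s * W s / q s) =
        1 / 2 * (1 - q t / q s) * (φ s * W s) := by ring
    have e2 : 1 / 2 * (|φ s| * V s) - 1 / 2 * q t * (|φ s| * V s / q s) =
        1 / 2 * (1 - q t / q s) * (|φ s| * V s) := by ring
    rw [e1, e2, Real.norm_eq_abs, abs_mul, abs_of_nonneg h2, abs_mul]
    exact mul_le_mul_of_nonneg_left (mul_le_mul_of_nonneg_left (hWV s) (abs_nonneg _)) h2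
  constructor
  · rw [← integral_abs_mul_forwardWeight hφ ht]
    exact key _ (continuous_forwardWeight hφ) hWb
  · refine (key _ hWc.abs fun _ => le_rfl).trans (sub_le_self _ ?_)
    have := hq t
    refine mul_nonneg (by positivity) (intervalIntegral.integral_nonneg ht fun s _ => ?_)
    have := hq s
    positivity

end Volterra

/-! ### Room in the error bounds, and the representation of all solutions. -/

section Volterra

variable {q φ W : ℝ → ℝ}

/-- Write `Q(t) = ∫₀ᵗ|φ|q`. The first bound is the discarded kernel term, but its factor `q(t)` may
decay. Feeding it into `E - 1 - |W - 1| ≥ ½∫₀ᵗ|φ|(E - |W|)` gives at least `¼∫₀ᵗ Q Q' = Q²/8`, which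
does not decay. -/
theorem VolterraEq.slack (hqc : Continuous q) (hq : ∀ t, 0 < q t) (hq1 : ∀ t, q t ≤ 1)
    (hqa : Antitone q) (hφ : Continuous φ) (hWc : Continuous W)
    (hWb : ∀ t, |W t| ≤ forwardWeight φ t) (hW : VolterraEq q φ 1 0 W) {t : ℝ} (ht : 0 ≤ t) :
    1 / 2 * q t * (∫ s in (0 : ℝ)..t, |φ s| * q s) ≤ forwardWeight φ t - 1 - |W t - 1| ∧
    (∫ s in (0 : ℝ)..t, |φ s| * q s) ^ 2 / 8 ≤ forwardWeight φ t - 1 - |W t - 1| := by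
  have hE := continuous_forwardWeight hφ
  have hc : Continuous fun s => |φ s| * q s := hφ.abs.mul hqc
  have hcE : Continuous fun s => |φ s| * forwardWeight φ s := hφ.abs.mul hE
  have hcW : Continuous fun s => |φ s| * |W s| := hφ.abs.mul hWc.abs
  have hcd : Continuous fun s => |φ s| * forwardWeight φ s / q s :=
    hcE.div hqc fun s => (hq s).ne'
  have h1 : ∀ t, 0 ≤ t → 1 / 2 * q t * (∫ s in (0 : ℝ)..t, |φ s| * q s) ≤
      forwardWeight φ t - 1 - |W t - 1| := by
    intro t ht
    have h := (hW.abs_sub_one_le hqc hq hqa hφ hWc hWb ht).1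
    have hmono : ∫ s in (0 : ℝ)..t, |φ s| * q s ≤
        ∫ s in (0 : ℝ)..t, |φ s| * forwardWeight φ s / q s := by
      refine intervalIntegral.integral_mono_on ht (hc.intervalIntegrable _ _)
        (hcd.intervalIntegrable _ _) fun s _ => ?_
      rw [mul_div_assoc]
      refine mul_le_mul_of_nonneg_left ?_ (abs_nonneg _)
      rw [le_div_iff₀ (hq s)]
      nlinarith [hq s, hq1 s, one_le_forwardWeight (φ := φ) s]
    have := mul_le_mul_of_nonneg_left hmono (by have := hq t; positivity : 0 ≤ 1 / 2 * q t)
    linarith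
  refine ⟨h1 t ht, ?_⟩
  have h := (hW.abs_sub_one_le hqc hq hqa hφ hWc hWb ht).2
  have hQc : Continuous fun t => ∫ s in (0 : ℝ)..t, |φ s| * q s :=
    intervalIntegral.continuous_primitive (fun a b => hc.intervalIntegrable a b) 0
  have hsq : ∫ u in (0 : ℝ)..t, 1 / 4 * ((∫ s in (0 : ℝ)..u, |φ s| * q s) * (|φ u| * q u)) =
      (∫ s in (0 : ℝ)..t, |φ s| * q s) ^ 2 / 8 := by
    have := intervalIntegral.integral_eq_sub_of_hasDerivAt (a := 0) (b := t)
      (f := fun u => (∫ s in (0 : ℝ)..u, |φ s| * q s) ^ 2 / 8)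
      (f' := fun u => 1 / 4 * ((∫ s in (0 : ℝ)..u, |φ s| * q s) * (|φ u| * q u)))
      (fun u _ => by
        have hd := intervalIntegral.integral_hasDerivAt_right (hc.intervalIntegrable 0 u)
          (hc.stronglyMeasurableAtFilter _ _) hc.continuousAt
        refine ((hd.pow 2).div_const 8).congr_deriv ?_
        push_cast
        ring)
      ((continuous_const.mul (hQc.mul hc)).intervalIntegrable _ _)
    rw [this]
    simp
  have hmono : ∫ u in (0 : ℝ)..t, 1 / 4 * ((∫ s in (0 : ℝ)..u, |φ s| * q s) * (|φ u| * q u)) ≤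
      ∫ u in (0 : ℝ)..t, 1 / 2 * (|φ u| * forwardWeight φ u - |φ u| * |W u|) := by
    refine intervalIntegral.integral_mono_on ht
      ((continuous_const.mul (hQc.mul hc)).intervalIntegrable _ _)
      ((continuous_const.mul (hcE.sub hcW)).intervalIntegrable _ _) fun u hu => ?_
    have h2 := h1 u hu.1
    have h3 : |W u| ≤ |W u - 1| + 1 := by
      have := abs_add_le (W u - 1) 1
      simpa using this
    have h4 : 1 / 2 * q u * (∫ s in (0 : ℝ)..u, |φ s| * q s) ≤ forwardWeight φ u - |W u| := by
      linarith
    have := mul_le_mul_of_nonneg_left h4 (by positivity : 0 ≤ 1 / 2 * |φ u|)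
    linarith
  rw [hsq, intervalIntegral.integral_const_mul, intervalIntegral.integral_sub
    (hcE.intervalIntegrable _ _) (hcW.intervalIntegrable _ _), mul_sub,
    integral_abs_mul_forwardWeight hφ ht] at hmono
  linarith

/-- If the two normalised solutions are proportional, then they satisfy their error bounds with
room to spare. -/
theorem exists_pos_le_slack (hqc : Continuous q) (hq : ∀ t, 0 < q t) (hq1 : ∀ t, q t ≤ 1)
    (hqa : Antitone q) (hφ : Continuous φ) (hφi : IntegrableOn φ (Ioi 0))
    {w₁ w₂ : ℝ → ℝ} (hw₁ : Continuous w₁) (hw₁b : ∀ t, |w₁ t| ≤ forwardWeight φ t)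
    (hV : VolterraEq q φ 1 0 w₁)
    (hw₂ : ∀ t, 0 ≤ t → |w₂ t - 1| ≤ backwardWeight φ t - 1 -
        1 / 2 / q t * ∫ s in Ioi t, |φ s| * backwardWeight φ s * q s)
    (hdeg : 1 + 1 / 2 * ∫ s in Ioi 0, φ s * w₂ s = 0) {c : ℝ} (hc0 : c ≠ 0) :
    ∃ σ, 0 < σ ∧ ∀ t, 0 ≤ t → σ ≤ (forwardWeight φ t - 1 - |w₁ t - 1|) +
      |c| * q t * (backwardWeight φ t - 1 - |w₂ t - 1|) := by
  have hc : Continuous fun s => |φ s| * q s := hφ.abs.mul hqc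
  have hqb : ∀ t, |q t| ≤ 1 := fun t => by rw [abs_of_pos (hq t)]; exact hq1 t
  have hci : IntegrableOn (fun s => |φ s| * q s) (Ioi 0) :=
    integrableOn_mul_of_bounded hφi.abs hqc hqb
  have hci' : IntegrableOn (fun s => |φ s| * backwardWeight φ s * q s) (Ioi 0) :=
    integrableOn_mul_of_bounded (integrableOn_mul_of_bounded hφi.abs
      (continuous_backwardWeight hφ hφi) fun s => by
      rw [abs_of_pos (zero_lt_one.trans_le (one_le_backwardWeight s))]
      exact backwardWeight_le hφ hφi s) hqc hqb
  -- If this vanished, `φ` would be zero a.e. on `(0, ∞)` and the left side of `hdeg` would be `1`.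
  have hpos : 0 < ∫ s in Ioi 0, |φ s| * q s := by
    refine (integral_nonneg fun s => mul_nonneg (abs_nonneg _) (hq s).le).lt_of_ne fun h0 => ?_
    have h1 := (integral_eq_zero_iff_of_nonneg
      (fun s => mul_nonneg (abs_nonneg _) (hq s).le) hci).1 h0.symm
    have h2 : ∫ s in Ioi 0, φ s * w₂ s = 0 := by
      refine integral_eq_zero_of_ae ?_
      filter_upwards [h1] with s hs
      have : φ s = 0 := by
        rcases mul_eq_zero.1 hs with h | h
        · exact abs_eq_zero.1 h
        · exact absurd h (hq s).ne'
      simp [this]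
    rw [h2] at hdeg
    norm_num at hdeg
  have hb : ∀ t, 0 ≤ t → 1 / 2 * (∫ s in Ioi t, |φ s| * q s) ≤
      q t * (backwardWeight φ t - 1 - |w₂ t - 1|) := by
    intro t ht
    have hmono : ∫ s in Ioi t, |φ s| * q s ≤ ∫ s in Ioi t, |φ s| * backwardWeight φ s * q s := by
      refine integral_mono (hci.mono_set (Ioi_subset_Ioi ht)) (hci'.mono_set (Ioi_subset_Ioi ht))
        fun s => ?_
      have := one_le_backwardWeight (φ := φ) s
      exact mul_le_mul_of_nonneg_right (le_mul_of_one_le_right (abs_nonneg _) this) (hq s).le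
    have h1 := mul_le_mul_of_nonneg_left (hw₂ t ht) (hq t).le
    have h2 : q t * (backwardWeight φ t - 1 -
        1 / 2 / q t * ∫ s in Ioi t, |φ s| * backwardWeight φ s * q s) =
        q t * (backwardWeight φ t - 1) -
          1 / 2 * ∫ s in Ioi t, |φ s| * backwardWeight φ s * q s := by
      have := (hq t).ne'
      field_simp
    rw [h2] at h1
    linarith
  set Qi := ∫ s in Ioi 0, |φ s| * q s with hQi
  have hlim := intervalIntegral_tendsto_integral_Ioi 0 hci tendsto_id
  obtain ⟨T, hT⟩ := eventually_atTop.1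
    ((tendsto_order.1 hlim).1 (Qi / 2) (by linarith))
  have hm : 0 < min 1 |c| := lt_min one_pos (abs_pos.2 hc0)
  -- After `T` at least half of `Qi` has accumulated, so `Q²/8 ≥ Qi²/32`. Before `T`, the forward
  -- room controls `Q(t)` with factor at least `½ q(T)` and the backward room controls `Qi - Q(t)`;
  -- together they see all of `Qi`.
  refine ⟨min (Qi ^ 2 / 32) (1 / 2 * q T * min 1 |c| * Qi), lt_min (by positivity)
    (by have := hq T; positivity), fun t ht => ?_⟩
  have hs1 := hV.slack hqc hq hq1 hqa hφ hw₁ hw₁b ht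
  have hs2 := hb t ht
  have hIoi : 0 ≤ ∫ s in Ioi t, |φ s| * q s :=
    integral_nonneg fun s => mul_nonneg (abs_nonneg _) (hq s).le
  have hI : 0 ≤ ∫ s in (0 : ℝ)..t, |φ s| * q s :=
    intervalIntegral.integral_nonneg ht fun s _ => mul_nonneg (abs_nonneg _) (hq s).le
  have hs3 : |c| * (1 / 2 * ∫ s in Ioi t, |φ s| * q s) ≤
      |c| * q t * (backwardWeight φ t - 1 - |w₂ t - 1|) := by
    rw [mul_assoc]
    exact mul_le_mul_of_nonneg_left hs2 (abs_nonneg _)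
  rcases le_total T t with h | h
  · refine (min_le_left _ _).trans ?_
    have h1 := hT t h
    simp only [id] at h1
    have h2 : 0 ≤ |c| * (1 / 2 * ∫ s in Ioi t, |φ s| * q s) := by positivity
    nlinarith [hs1.2]
  · refine (min_le_right _ _).trans ?_
    have hsum : (∫ s in (0 : ℝ)..t, |φ s| * q s) + ∫ s in Ioi t, |φ s| * q s = Qi :=
      integral_add_integral_Ioi hc hci t
    have h1 : 1 / 2 * q T * min 1 |c| * Qi ≤ 1 / 2 * q t * min 1 |c| * Qi := by
      have := hqa h
      gcongr
    have h2 : 1 / 2 * q t * min 1 |c| * (∫ s in (0 : ℝ)..t, |φ s| * q s) ≤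
        1 / 2 * q t * (∫ s in (0 : ℝ)..t, |φ s| * q s) := by
      refine mul_le_mul_of_nonneg_right ?_ hI
      have := hq t
      exact mul_le_of_le_one_right (by positivity) (min_le_left _ _)
    have h3 : 1 / 2 * q t * min 1 |c| * (∫ s in Ioi t, |φ s| * q s) ≤
        |c| * (1 / 2 * ∫ s in Ioi t, |φ s| * q s) := by
      have e : |c| * (1 / 2 * ∫ s in Ioi t, |φ s| * q s) =
        1 / 2 * 1 * |c| * ∫ s in Ioi t, |φ s| * q s := by ring
      rw [e]
      refine mul_le_mul_of_nonneg_right ?_ hIoi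
      exact mul_le_mul (by linarith [hq1 t]) (min_le_right _ _) hm.le (by norm_num)
    rw [← hsum] at h1 ⊢
    rw [mul_add] at h1
    linarith [hs1.1]

/-- A function that is dominated by the error terms of a Liouville-Green sum is such a sum with
other errors. -/
theorem exists_error_terms {e₁ e₂ q D : ℝ → ℝ} {A B : ℝ} (he₁ : Continuous e₁)
    (he₂ : Continuous e₂) (hqc : Continuous q) (hD : Continuous D)
    (hb : ∀ t, 0 ≤ t → 0 < |A| * e₁ t + |B| * q t * e₂ t)
    (hDb : ∀ t, 0 ≤ t → |D t| ≤ |A| * e₁ t + |B| * q t * e₂ t)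
    (he₁0 : ∀ t, 0 ≤ e₁ t) (he₂0 : ∀ t, 0 ≤ e₂ t) :
    ∃ δ₁ δ₂ : ℝ → ℝ, ContinuousOn δ₁ (Ici 0) ∧ ContinuousOn δ₂ (Ici 0) ∧
      ∀ t, 0 ≤ t → |δ₁ t| ≤ e₁ t ∧ |δ₂ t| ≤ e₂ t ∧ D t = A * δ₁ t + B * q t * δ₂ t := by
  have hθ : ContinuousOn (fun t => D t / (|A| * e₁ t + |B| * q t * e₂ t)) (Ici 0) :=
    hD.continuousOn.div (by fun_prop) fun t ht => (hb t ht).ne'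
  have hsign : ∀ x : ℝ, |(SignType.sign x : ℝ)| ≤ 1 := fun x => by
    rcases lt_trichotomy x 0 with h | h | h <;> simp [h]
  -- Both errors use the same fraction of their allowance, namely `D` divided by the total
  -- allowance; the signs turn `A, B` into `|A|, |B|`, so the contributions add up to `D`.
  refine ⟨fun t => SignType.sign A * (D t / (|A| * e₁ t + |B| * q t * e₂ t)) * e₁ t,
    fun t => SignType.sign B * (D t / (|A| * e₁ t + |B| * q t * e₂ t)) * e₂ t,
    (continuousOn_const.mul hθ).mul he₁.continuousOn,
    (continuousOn_const.mul hθ).mul he₂.continuousOn, fun t ht => ?_⟩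
  have hθ1 : |D t / (|A| * e₁ t + |B| * q t * e₂ t)| ≤ 1 := by
    rw [abs_div, abs_of_pos (hb t ht), div_le_one (hb t ht)]
    exact hDb t ht
  refine ⟨?_, ?_, ?_⟩
  · rw [abs_mul, abs_mul, abs_of_nonneg (he₁0 t)]
    exact mul_le_of_le_one_left (he₁0 t) (mul_le_one₀ (hsign _) (abs_nonneg _) hθ1)
  · rw [abs_mul, abs_mul, abs_of_nonneg (he₂0 t)]
    exact mul_le_of_le_one_left (he₂0 t) (mul_le_one₀ (hsign _) (abs_nonneg _) hθ1)
  · have hA := self_mul_sign A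
    have hB := self_mul_sign B
    calc D t = D t / (|A| * e₁ t + |B| * q t * e₂ t) * (|A| * e₁ t + |B| * q t * e₂ t) :=
          (div_mul_cancel₀ _ (hb t ht).ne').symm
      _ = _ := by
        rw [← hA, ← hB]
        ring

/-- Liouville-Green representation of the solutions of the Volterra equation. -/
theorem exists_liouvilleGreen_volterra (hqc : Continuous q) (hq : ∀ t, 0 < q t)
    (hq1 : ∀ t, q t ≤ 1) (hqa : Antitone q) (hqm : ∀ t, q (max t 0) = q t) (hφ : Continuous φ)
    (hφi : IntegrableOn φ (Ioi 0)) :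
    ∃ w₁ w₂ : ℝ → ℝ, Continuous w₁ ∧ Continuous w₂ ∧
      VolterraEq q φ 1 0 w₁ ∧ (∃ k₀ k₁, VolterraEq q φ k₀ k₁ fun t => q t * w₂ t) ∧
      (∀ t, 0 ≤ t → |w₁ t - 1| ≤ forwardWeight φ t - 1 ∧ |w₂ t - 1| ≤ backwardWeight φ t - 1) ∧
      ∀ k₀ k₁, ∃ W, Continuous W ∧ VolterraEq q φ k₀ k₁ W ∧
        ∃ (A B : ℝ) (δ₁ δ₂ : ℝ → ℝ), ContinuousOn δ₁ (Ici 0) ∧ ContinuousOn δ₂ (Ici 0) ∧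
          ∀ t, 0 ≤ t → |δ₁ t| ≤ forwardWeight φ t - 1 ∧ |δ₂ t| ≤ backwardWeight φ t - 1 ∧
            W t = A * (1 + δ₁ t) + B * q t * (1 + δ₂ t) := by
  obtain ⟨w₁, hw₁, hV₁, hb₁⟩ := exists_volterraEq hqc hq hq1 hqa hqm hφ hφi 1 0
  obtain ⟨w₂, hw₂, hb₂, hV₂, hs₂⟩ := exists_recessive hqc hq hq1 hqa hqm hφ hφi
  simp only [abs_one, abs_zero, add_zero, one_mul] at hb₁
  have hqw₂ : Continuous fun t => q t * w₂ t := hqc.mul hw₂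
  have hbd : ∀ t, 0 ≤ t →
      |w₁ t - 1| ≤ forwardWeight φ t - 1 ∧ |w₂ t - 1| ≤ backwardWeight φ t - 1 := by
    intro t ht
    constructor
    · have h1 := (hV₁.slack hqc hq hq1 hqa hφ hw₁ hb₁ ht).2
      nlinarith [sq_nonneg (∫ s in (0 : ℝ)..t, |φ s| * q s)]
    · have h1 := hs₂ t ht
      have h2 : 0 ≤ 1 / 2 / q t * ∫ s in Ioi t, |φ s| * backwardWeight φ s * q s := by
        have := hq t
        refine mul_nonneg (by positivity) (integral_nonneg fun s => ?_)
        have := one_le_backwardWeight (φ := φ) s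
        have := hq s
        positivity
      linarith
  refine ⟨w₁, w₂, hw₁, hw₂, hV₁, ⟨_, _, hV₂⟩, hbd, fun k₀ k₁ => ?_⟩
  set l₀ := -(1 / 2 * ∫ s in Ioi 0, φ s * w₂ s * q s)
  set l₁ := 1 + 1 / 2 * ∫ s in Ioi 0, φ s * w₂ s with hl₁
  by_cases hdeg : l₁ = 0
  -- Degenerate case: `q w₂ - l₀ w₁` solves the homogeneous Volterra equation, hence vanishes.
  · have hl₀ : ∀ t, 0 ≤ t → q t * w₂ t = l₀ * w₁ t := by
      intro t ht
      have h := hV₂.lincomb hqc hq hφ hqw₂ hw₁ hV₁ 1 (-l₀)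
      rw [hdeg] at h
      have h' : VolterraEq q φ 0 0 fun t => 1 * (q t * w₂ t) + -l₀ * w₁ t := by
        convert h using 1 <;> ring
      have := h'.eq_zero hqc hq hqa hqm hφ hφi (by fun_prop)
        (B := Real.exp (1 / 2 * ∫ s in Ioi 0, |φ s|) +
          |l₀| * Real.exp (1 / 2 * ∫ s in Ioi 0, |φ s|)) (fun t _ => by
          refine (abs_add_le _ _).trans (add_le_add ?_ ?_)
          · rw [one_mul, abs_mul, abs_of_pos (hq t)]
            exact (mul_le_of_le_one_left (abs_nonneg _) (hq1 t)).trans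
              ((hb₂ t).trans (backwardWeight_le hφ hφi t))
          · rw [abs_mul, abs_neg]
            exact mul_le_mul_of_nonneg_left ((hb₁ t).trans (forwardWeight_le hφ hφi t))
              (abs_nonneg _)) ht
      linarith
    have hl₀0 : l₀ ≠ 0 := by
      intro h0
      have hw0 : ∀ t, 0 ≤ t → w₂ t = 0 := fun t ht => by
        have := hl₀ t ht
        rw [h0, zero_mul] at this
        exact (mul_eq_zero.1 this).resolve_left (hq t).ne'
      have : ∫ s in Ioi 0, φ s * w₂ s = 0 := by
        refine setIntegral_eq_zero_of_forall_eq_zero fun s hs => ?_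
        rw [hw0 s (le_of_lt hs), mul_zero]
      rw [hl₁, this] at hdeg
      norm_num at hdeg
    obtain ⟨W, hWc, hWV, hWb⟩ := exists_volterraEq hqc hq hq1 hqa hqm hφ hφi k₀ k₁
    obtain ⟨σ, hσ, hsl⟩ := exists_pos_le_slack hqc hq hq1 hqa hφ hφi hw₁ hb₁ hV₁ hs₂ hdeg
      (inv_ne_zero hl₀0)
    set N := (|k₀| + |k₁|) * Real.exp (1 / 2 * ∫ s in Ioi 0, |φ s|)
    have hN : ∀ t, |W t| ≤ N := fun t => (hWb t).trans
      (mul_le_mul_of_nonneg_left (forwardWeight_le hφ hφi t) (by positivity))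
    have hN0 : 0 ≤ N := (abs_nonneg _).trans (hN 0)
    -- The room `A σ` must exceed the bound `N` of `|W|`; the extra `1` keeps the total allowance
    -- strictly positive, since it serves as a denominator.
    set A := (N + 1) / σ with hA
    have hA0 : 0 < A := by positivity
    have hAσ : A * σ = N + 1 := by rw [hA]; field_simp
    -- Makes `A w₁ + B q w₂ = 0`. Then `W = A(1 + δ₁) + B q(1 + δ₂)` amounts to `A δ₁ + B q δ₂ = W +
    -- A(w₁ - 1) + B q(w₂ - 1)`.
    set B := -(A * l₀⁻¹) with hB
    have hBabs : |B| = A * |l₀⁻¹| := by rw [hB, abs_neg, abs_mul, abs_of_pos hA0]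
    have hDb : ∀ t, 0 ≤ t → |W t + A * (w₁ t - 1) + B * q t * (w₂ t - 1)| + 1 ≤
        |A| * (forwardWeight φ t - 1) + |B| * q t * (backwardWeight φ t - 1) := by
      intro t ht
      have h1 := abs_add_three (W t) (A * (w₁ t - 1)) (B * q t * (w₂ t - 1))
      rw [abs_mul A, abs_mul (B * q t), abs_mul B, abs_of_pos (hq t)] at h1
      have h2 := mul_le_mul_of_nonneg_left (hsl t ht) hA0.le
      have h3 := hN t
      rw [hBabs] at h1 ⊢
      rw [abs_of_pos hA0] at h1 ⊢
      nlinarith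
    obtain ⟨δ₁, δ₂, hδ₁, hδ₂, hδ⟩ := exists_error_terms (q := q) (A := A) (B := B)
      (e₁ := fun t => forwardWeight φ t - 1) (e₂ := fun t => backwardWeight φ t - 1)
      (D := fun t => W t + A * (w₁ t - 1) + B * q t * (w₂ t - 1))
      ((continuous_forwardWeight hφ).sub continuous_const)
      ((continuous_backwardWeight hφ hφi).sub continuous_const) hqc (by fun_prop)
      (fun t ht => by
        have := hDb t ht
        have := abs_nonneg (W t + A * (w₁ t - 1) + B * q t * (w₂ t - 1))
        linarith)
      (fun t ht => by
        have := hDb t ht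
        linarith)
      (fun t => sub_nonneg.2 (one_le_forwardWeight t))
      (fun t => sub_nonneg.2 (one_le_backwardWeight t))
    refine ⟨W, hWc, hWV, A, B, δ₁, δ₂, hδ₁, hδ₂, fun t ht => ?_⟩
    obtain ⟨h1, h2, h3⟩ := hδ t ht
    refine ⟨h1, h2, ?_⟩
    have h4 : B * (q t * w₂ t) = -(A * w₁ t) := by
      rw [hl₀ t ht, hB]
      field_simp
    linarith
  -- As `l₁ ≠ 0`, the constants `(1, 0)` and `(l₀, l₁)` form a basis, and these are the coordinates
  -- of `(k₀, k₁)`.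
  · refine ⟨fun t => (k₀ - k₁ / l₁ * l₀) * w₁ t + k₁ / l₁ * (q t * w₂ t), by fun_prop, ?_,
      k₀ - k₁ / l₁ * l₀, k₁ / l₁, fun t => w₁ t - 1, fun t => w₂ t - 1, by fun_prop, by fun_prop,
      fun t ht => ⟨(hbd t ht).1, (hbd t ht).2, by ring⟩⟩
    have h := hV₁.lincomb hqc hq hφ hw₁ hqw₂ hV₂ (k₀ - k₁ / l₁ * l₀) (k₁ / l₁)
    convert h using 1
    · ring
    · field_simp
      ring

end Volterra

/-! ### From the integral equation to the differential equation. -/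

/-- The exponential factor `exp (-2 ∫_0^t σ)`, constant for `t ≤ 0`. -/
noncomputable def decayFactor (σ : ℝ → ℝ) (t : ℝ) : ℝ :=
  Real.exp (-2 * ∫ s in (0 : ℝ)..max t 0, σ s)

section Decay

variable {σ : ℝ → ℝ}

theorem decayFactor_pos (t : ℝ) : 0 < decayFactor σ t := Real.exp_pos _

theorem decayFactor_max (t : ℝ) : decayFactor σ (max t 0) = decayFactor σ t := by
  rw [decayFactor, decayFactor, max_eq_left (le_max_right _ _)]

theorem continuous_decayFactor (hσ : Continuous σ) : Continuous (decayFactor σ) :=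
  Real.continuous_exp.comp (continuous_const.mul (continuous_primitive_max hσ))

theorem antitone_decayFactor (hσ : Continuous σ) (hσ0 : ∀ t, 0 ≤ σ t) :
    Antitone (decayFactor σ) := by
  intro s t hst
  refine Real.exp_le_exp.2 ?_
  have h : ∫ u in (0 : ℝ)..max s 0, σ u ≤ ∫ u in (0 : ℝ)..max t 0, σ u :=
    intervalIntegral.integral_mono_interval le_rfl (le_max_right _ _)
      (max_le_max_right _ hst) (Eventually.of_forall hσ0) (hσ.intervalIntegrable _ _)
  linarith

theorem decayFactor_le_one (hσ0 : ∀ t, 0 ≤ σ t) (t : ℝ) : decayFactor σ t ≤ 1 := by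
  refine Real.exp_le_one_iff.2 ?_
  have := intervalIntegral.integral_nonneg (μ := volume) (f := σ) (le_max_right t 0)
    fun s _ => hσ0 s
  linarith

theorem hasDerivAt_integral_zero {f : ℝ → ℝ} (hf : Continuous f) (t : ℝ) :
    HasDerivAt (fun t => ∫ s in (0 : ℝ)..t, f s) (f t) t :=
  intervalIntegral.integral_hasDerivAt_right (hf.intervalIntegrable _ _)
    (hf.stronglyMeasurableAtFilter _ _) hf.continuousAt

theorem hasDerivWithinAt_decayFactor (hσ : Continuous σ) {t : ℝ} (ht : 0 ≤ t) :
    HasDerivWithinAt (decayFactor σ) (-2 * σ t * decayFactor σ t) (Ici 0) t := by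
  have h := (((hasDerivAt_integral_zero hσ t).const_mul (-2)).exp).hasDerivWithinAt (s := Ici 0)
  have he : ∀ s, 0 ≤ s → decayFactor σ s = Real.exp (-2 * ∫ u in (0 : ℝ)..s, σ u) :=
    fun s hs => by rw [decayFactor, max_eq_left hs]
  refine (h.congr (fun s hs => he s hs) (he t ht)).congr_deriv ?_
  rw [he t ht]
  ring

end Decay

/-- The contributions from the moving endpoint cancel because the kernel vanishes at `s = t`; only
`q` gets differentiated. The remaining bracket, called `Z` below, is again differentiable. -/
theorem VolterraEq.hasDerivWithinAt {q φ W σ : ℝ → ℝ} {k₀ k₁ : ℝ} (hqc : Continuous q)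
    (hq : ∀ t, 0 < q t) (hφ : Continuous φ) (hWc : Continuous W) (hW : VolterraEq q φ k₀ k₁ W)
    (hqd : ∀ t, 0 ≤ t → HasDerivWithinAt q (-2 * σ t * q t) (Ici 0) t) {t : ℝ} (ht : 0 ≤ t) :
    HasDerivWithinAt W
      (-2 * σ t * q t * (k₁ - 1 / 2 * ∫ s in (0 : ℝ)..t, φ s * W s / q s)) (Ici 0) t := by
  have hd : Continuous fun s => φ s * W s / q s := (hφ.mul hWc).div hqc fun s => (hq s).ne'
  have h1 := (hasDerivAt_integral_zero (hφ.mul hWc) t).hasDerivWithinAt (s := Ici 0)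
  have h2 := (hasDerivAt_integral_zero hd t).hasDerivWithinAt (s := Ici 0)
  have h := ((((hqd t ht).const_mul k₁).const_add k₀).add
    ((h1.const_mul (1 / 2)).sub (((hqd t ht).const_mul (1 / 2)).mul h2)))
  refine (h.congr (fun s hs => hW s hs) (hW t ht)).congr_deriv ?_
  have := (hq t).ne'
  simp only [Pi.mul_apply]
  field_simp
  ring

/-- The first two derivatives of a Liouville-Green product, and the equation it satisfies. -/
theorem hasDerivWithinAt_liouvilleGreen {p p' r r' r'' m φ I q W Z : ℝ → ℝ}
    (hp : ∀ t, 0 ≤ t → HasDerivWithinAt p (p' t) (Ici 0) t)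
    (hr : ∀ t, 0 ≤ t → HasDerivWithinAt r (r' t) (Ici 0) t)
    (hr' : ∀ t, 0 ≤ t → HasDerivWithinAt r' (r'' t) (Ici 0) t)
    (hr0 : ∀ t, 0 ≤ t → 0 < r t) (hrm : ∀ t, 0 ≤ t → r t = p t ^ 2 / 4 + p' t / 2 - m t)
    (hφ : ∀ t, 0 ≤ t → φ t = (4 * r t * r'' t - 5 * r' t ^ 2) / (16 * r t ^ (5 / 2 : ℝ)))
    (hI : ∀ t, 0 ≤ t → HasDerivWithinAt I (-(p t / 2) + √(r t)) (Ici 0) t)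
    (hq : ∀ t, 0 ≤ t → HasDerivWithinAt q (-2 * √(r t) * q t) (Ici 0) t) (hq0 : ∀ t, 0 < q t)
    (hW : ∀ t, 0 ≤ t → HasDerivWithinAt W (-2 * √(r t) * q t * Z t) (Ici 0) t)
    (hZ : ∀ t, 0 ≤ t → HasDerivWithinAt Z (-(1 / 2 * (φ t * W t / q t))) (Ici 0) t) :
    ∃ v a : ℝ → ℝ, ∀ t, 0 ≤ t →
      HasDerivWithinAt (fun t => Real.exp (I t) / r t ^ (1 / 4 : ℝ) * W t) (v t) (Ici 0) t ∧
      HasDerivWithinAt v (a t) (Ici 0) t ∧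
      a t + p t * v t + m t * (Real.exp (I t) / r t ^ (1 / 4 : ℝ) * W t) = 0 ∧
      v t = Real.exp (I t) / r t ^ (1 / 4 : ℝ) *
        ((-(p t / 2) + √(r t) - r' t / (4 * r t)) * W t - 2 * √(r t) * q t * Z t) := by
  set P : ℝ → ℝ := fun t => Real.exp (I t) / r t ^ (1 / 4 : ℝ) with hP
  set h : ℝ → ℝ := fun t => -(p t / 2) + √(r t) - r' t / (4 * r t) with hh
  have hPd : ∀ t, 0 ≤ t → HasDerivWithinAt P (P t * h t) (Ici 0) t := fun t ht => by
    have hrt := hr0 t ht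
    have hpow : 0 < r t ^ (1 / 4 : ℝ) := Real.rpow_pos_of_pos hrt _
    have h1 := (hr t ht).rpow_const (p := 1 / 4) (Or.inl hrt.ne')
    refine ((hI t ht).exp.div h1 hpow.ne').congr_deriv ?_
    rw [Real.rpow_sub_one hrt.ne']
    simp only [hP, hh]
    field_simp
  have hhd : ∀ t, 0 ≤ t → HasDerivWithinAt h (-(p' t / 2) + r' t / (2 * √(r t)) -
      (r'' t * (4 * r t) - r' t * (4 * r' t)) / (4 * r t) ^ 2) (Ici 0) t := fun t ht => by
    have hrt := hr0 t ht
    exact ((hp t ht).div_const 2).neg.add ((hr t ht).sqrt hrt.ne') |>.sub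
      ((hr' t ht).div ((hr t ht).const_mul 4) (by positivity))
  refine ⟨fun t => P t * (h t * W t - 2 * √(r t) * q t * Z t), fun t =>
    P t * h t * (h t * W t - 2 * √(r t) * q t * Z t) + P t *
      (((-(p' t / 2) + r' t / (2 * √(r t)) -
        (r'' t * (4 * r t) - r' t * (4 * r' t)) / (4 * r t) ^ 2) * W t +
          h t * (-2 * √(r t) * q t * Z t)) -
        ((2 * (r' t / (2 * √(r t))) * q t + 2 * √(r t) * (-2 * √(r t) * q t)) * Z t +
          2 * √(r t) * q t * -(1 / 2 * (φ t * W t / q t)))), fun t ht => ⟨?_, ?_, ?_, ?_⟩⟩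
  · refine ((hPd t ht).mul (hW t ht)).congr_deriv ?_
    ring
  · exact (hPd t ht).mul (((hhd t ht).mul (hW t ht)).sub
      (((((hr t ht).sqrt (hr0 t ht).ne').const_mul 2).mul (hq t ht)).mul (hZ t ht)))
  · have hrt := hr0 t ht
    have h52 : r t ^ (5 / 2 : ℝ) = r t ^ 2 * √(r t) := by
      rw [Real.sqrt_eq_rpow, ← Real.rpow_natCast, ← Real.rpow_add hrt]
      norm_num
    have hφt := hφ t ht
    rw [h52] at hφt
    have hrmt := hrm t ht
    have hq0' := (hq0 t).ne'
    -- With `r = S²` and `m` eliminated, the differential equation becomes a rational identity.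
    set S := √(r t) with hS
    have hSpos : 0 < S := Real.sqrt_pos.2 hrt
    have hSS : r t = S ^ 2 := (Real.sq_sqrt hrt.le).symm
    have hmt : m t = p t ^ 2 / 4 + p' t / 2 - S ^ 2 := by rw [← hSS]; linarith
    have hPt : Real.exp (I t) / r t ^ (1 / 4 : ℝ) = P t := rfl
    beta_reduce
    rw [hPt, hφt, hmt]
    generalize P t = Pt
    simp only [hh]
    rw [← hS, hSS]
    field_simp
    ring
  · simp only [hP, hh]

/-! ### Uniqueness for the initial value problem. -/

theorem IsSolution.congr {ε α x y : ℝ → ℝ} {β lam : ℝ} (h : IsSolution ε α β lam x)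
    (hxy : ∀ t, 0 ≤ t → y t = x t) : IsSolution ε α β lam y := by
  obtain ⟨v, a, hva⟩ := h
  refine ⟨v, a, fun t ht => ?_⟩
  obtain ⟨h1, h2, h3⟩ := hva t ht
  exact ⟨h1.congr (fun s hs => hxy s hs) (hxy t ht), h2, by rw [hxy t ht]; exact h3⟩

/-- The initial value problem has at most one solution. -/
theorem IsSolution.eq_of_initial {ε α x y : ℝ → ℝ} {β lam : ℝ}
    (hε : ContinuousOn ε (Ici 0)) (hε0 : ∀ t, 0 ≤ t → 0 < ε t) (hα : ContinuousOn α (Ici 0))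
    (hx : IsSolution ε α β lam x) (hy : IsSolution ε α β lam y) (h0 : y 0 = x 0)
    (hd0 : dt y 0 = dt x 0) {t : ℝ} (ht : 0 ≤ t) : y t = x t := by
  obtain ⟨v, a, hva⟩ := hx
  obtain ⟨w, b, hwb⟩ := hy
  have hv0 : w 0 = v 0 := by
    have hu : UniqueDiffWithinAt ℝ (Ici (0 : ℝ)) 0 := uniqueDiffOn_Ici 0 0 self_mem_Ici
    rw [← (hwb 0 le_rfl).1.derivWithin hu, ← (hva 0 le_rfl).1.derivWithin hu]
    exact hd0
  have hsub : Icc 0 t ⊆ Ici (0 : ℝ) := Icc_subset_Ici_self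
  have hne : ∀ s ∈ Icc 0 t, ε s ≠ 0 := fun s hs => (hε0 s hs.1).ne'
  have hc1 : ContinuousOn (fun s => (α s + β * lam) / ε s) (Icc 0 t) :=
    ((hα.mono hsub).add continuousOn_const).div (hε.mono hsub) hne
  have hc2 : ContinuousOn (fun s => lam / ε s) (Icc 0 t) :=
    continuousOn_const.div (hε.mono hsub) hne
  obtain ⟨K₁, hK₁⟩ := isCompact_Icc.exists_bound_of_continuousOn hc1
  obtain ⟨K₂, hK₂⟩ := isCompact_Icc.exists_bound_of_continuousOn hc2
  have h00 : (0 : ℝ) ∈ Icc 0 t := ⟨le_rfl, ht⟩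
  have hK₁0 := (norm_nonneg _).trans (hK₁ 0 h00)
  have hK₂0 := (norm_nonneg _).trans (hK₂ 0 h00)
  -- The equation as a first-order system, Lipschitz on `[0, t]` because `ε` is bounded away from
  -- `0` on compact intervals.
  let F : ℝ → ℝ × ℝ → ℝ × ℝ := fun s z =>
    (z.2, -((α s + β * lam) / ε s) * z.2 - lam / ε s * z.1)
  have hF : ∀ s ∈ Ico 0 t,
      LipschitzOnWith (1 + K₁ + K₂).toNNReal (F s) univ := fun s hs => by
    refine LipschitzOnWith.of_dist_le_mul fun z _ z' _ => ?_
    rw [Real.coe_toNNReal _ (by positivity)]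
    have hs' : s ∈ Icc 0 t := Ico_subset_Icc_self hs
    have e1 := hK₁ s hs'
    have e2 := hK₂ s hs'
    rw [Real.norm_eq_abs] at e1 e2
    have d1 : dist z.1 z'.1 ≤ dist z z' := by rw [Prod.dist_eq]; exact le_max_left _ _
    have d2 : dist z.2 z'.2 ≤ dist z z' := by rw [Prod.dist_eq]; exact le_max_right _ _
    rw [Prod.dist_eq]
    refine max_le ?_ ?_
    · simp only [F]
      nlinarith [dist_nonneg (x := z) (y := z')]
    · simp only [F]
      rw [Real.dist_eq] at d1 d2 ⊢
      have e3 : -((α s + β * lam) / ε s) * z.2 - lam / ε s * z.1 -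
          (-((α s + β * lam) / ε s) * z'.2 - lam / ε s * z'.1) =
          -((α s + β * lam) / ε s * (z.2 - z'.2)) - lam / ε s * (z.1 - z'.1) := by ring
      rw [e3]
      refine (abs_sub _ _).trans ?_
      rw [abs_neg, abs_mul, abs_mul]
      have f1 := mul_le_mul e1 d2 (abs_nonneg _) hK₁0
      have f2 := mul_le_mul e2 d1 (abs_nonneg _) hK₂0
      nlinarith [dist_nonneg (x := z) (y := z')]
  have key : ∀ {z u c : ℝ → ℝ}, (∀ s, 0 ≤ s →
      HasDerivWithinAt z (u s) (Ici 0) s ∧ HasDerivWithinAt u (c s) (Ici 0) s ∧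
      ε s * c s + (α s + β * lam) * u s + lam * z s = 0) →
      ContinuousOn (fun s => (z s, u s)) (Icc 0 t) ∧
      ∀ s ∈ Ico 0 t, HasDerivWithinAt (fun s => (z s, u s)) (F s (z s, u s)) (Ici s) s := by
    intro z u c hz
    refine ⟨fun s hs => ?_, fun s hs => ?_⟩
    · exact ((hz s hs.1).1.continuousWithinAt.prodMk (hz s hs.1).2.1.continuousWithinAt).mono hsub
    · obtain ⟨h1, h2, h3⟩ := hz s hs.1
      have h4 := (h1.prodMk h2).mono (Ici_subset_Ici.2 hs.1)
      refine h4.congr_deriv ?_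
      have hεs := (hε0 s hs.1).ne'
      simp only [F, Prod.mk.injEq, true_and]
      field_simp
      linarith
  obtain ⟨kx, kx'⟩ := key hva
  obtain ⟨ky, ky'⟩ := key hwb
  have := ODE_solution_unique_of_mem_Icc_right (v := F) (s := fun _ => univ) hF ky ky'
    (fun _ _ => mem_univ _) kx kx' (fun _ _ => mem_univ _) (by simp [h0, hv0])
  exact congrArg Prod.fst (this ⟨ht, le_rfl⟩)

/-! ### Bounded, integrable and smooth functions on the half-line. -/

section HalfLine

variable {f g : ℝ → ℝ}

/-- Continuous and bounded on `[0, ∞)`. -/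
def BddContOn (f : ℝ → ℝ) : Prop := ContinuousOn f (Ici 0) ∧ ∃ B, ∀ t, 0 ≤ t → |f t| ≤ B

theorem BddContOn.of_tendsto {L : ℝ} (hf : ContinuousOn f (Ici 0)) (hL : Tendsto f atTop (𝓝 L)) :
    BddContOn f := by
  refine ⟨hf, ?_⟩
  obtain ⟨T, hT⟩ := eventually_atTop.1 (hL.abs.eventually (gt_mem_nhds (lt_add_one |L|)))
  obtain ⟨B, hB⟩ := (isCompact_Icc (a := (0 : ℝ)) (b := T)).exists_bound_of_continuousOn
    (hf.mono Icc_subset_Ici_self)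
  refine ⟨max B (|L| + 1), fun t ht => ?_⟩
  rcases le_total t T with h | h
  · exact (hB t ⟨ht, h⟩).trans (le_max_left _ _)
  · exact (hT t h).le.trans (le_max_right _ _)

theorem BddContOn.add (hf : BddContOn f) (hg : BddContOn g) : BddContOn fun t => f t + g t := by
  obtain ⟨hf, A, hA⟩ := hf
  obtain ⟨hg, B, hB⟩ := hg
  exact ⟨hf.add hg, A + B, fun t ht => (abs_add_le _ _).trans (add_le_add (hA t ht) (hB t ht))⟩

theorem BddContOn.mul (hf : BddContOn f) (hg : BddContOn g) : BddContOn fun t => f t * g t := by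
  obtain ⟨hf, A, hA⟩ := hf
  obtain ⟨hg, B, hB⟩ := hg
  refine ⟨hf.mul hg, A * B, fun t ht => ?_⟩
  rw [abs_mul]
  exact mul_le_mul (hA t ht) (hB t ht) (abs_nonneg _) ((abs_nonneg _).trans (hA t ht))

theorem BddContOn.const (c : ℝ) : BddContOn fun _ => c :=
  ⟨continuousOn_const, |c|, fun _ _ => le_rfl⟩

theorem BddContOn.const_mul (c : ℝ) (hf : BddContOn f) : BddContOn fun t => c * f t :=
  (BddContOn.const c).mul hf

theorem IntegrableOn.mul_bddContOn (hf : IntegrableOn f (Ici 0)) (hg : BddContOn g) :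
    IntegrableOn (fun t => f t * g t) (Ici 0) := by
  obtain ⟨hgc, B, hB⟩ := hg
  refine Integrable.mul_bdd (c := B) hf (hgc.aestronglyMeasurable measurableSet_Ici) ?_
  filter_upwards [ae_restrict_mem measurableSet_Ici] with t ht using hB t ht

theorem uniqueDiffWithinAt_Ici_zero {t : ℝ} (ht : 0 ≤ t) : UniqueDiffWithinAt ℝ (Ici (0 : ℝ)) t :=
  uniqueDiffOn_Ici 0 t ht

theorem ContDiffOn.hasDerivWithinAt_dt {n : WithTop ℕ∞} (hf : ContDiffOn ℝ n f (Ici 0))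
    (hn : n ≠ 0) {t : ℝ} (ht : 0 ≤ t) : HasDerivWithinAt f (dt f t) (Ici 0) t :=
  ((hf.differentiableOn hn) t ht).hasDerivWithinAt

theorem ContDiffOn.dt {m n : WithTop ℕ∞} (hf : ContDiffOn ℝ n f (Ici 0)) (hmn : m + 1 ≤ n) :
    ContDiffOn ℝ m (dt f) (Ici 0) :=
  hf.derivWithin (uniqueDiffOn_Ici 0) hmn

theorem tendsto_zero_of_integrableOn_dt {f' : ℝ → ℝ}
    (hd : ∀ t, 0 ≤ t → HasDerivWithinAt f (f' t) (Ici 0) t)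
    (hf : IntegrableOn f (Ici 0)) (hf' : IntegrableOn f' (Ici 0)) : Tendsto f atTop (𝓝 0) :=
  tendsto_zero_of_hasDerivAt_of_integrableOn_Ioi (a := 0)
    (fun t ht => (hd t (le_of_lt ht)).hasDerivAt (Ici_mem_nhds ht))
    (hf'.mono_set Ioi_subset_Ici_self) (hf.mono_set Ioi_subset_Ici_self)

end HalfLine

/-! ### Positivity of `r` and integrability of `φ`. -/

/-- Standing assumptions on the variable mass `ε` and the damping `α`. -/
structure DampingData (ε α : ℝ → ℝ) (β lam : ℝ) : Prop where
  β_pos : 0 < β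
  lam_pos : 0 < lam
  α_nonneg : ∀ t : ℝ, 0 ≤ t → 0 ≤ α t
  ε_anti : AntitoneOn ε (Ici 0)
  ε_pos : ∀ t : ℝ, 0 ≤ t → 0 < ε t
  α_smooth : ContDiffOn ℝ 3 α (Ici 0)
  ε_smooth : ContDiffOn ℝ 3 ε (Ici 0)
  ε_zero : ∀ t : ℝ, 0 ≤ t → ε 0 < (β * lam) ^ 2 / (2 * |dt α t| + 4 * lam)
  α_int₁ : IntegrableOn (dt α) (Ici 0)
  α_int₂ : IntegrableOn (dt (dt α)) (Ici 0)
  α_int₃ : IntegrableOn (dt (dt (dt α))) (Ici 0)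
  ε_int₁ : IntegrableOn (dt ε) (Ici 0)
  ε_int₂ : IntegrableOn (dt (dt ε)) (Ici 0)
  ε_int₃ : IntegrableOn (dt (dt (dt ε))) (Ici 0)
  ε_lim : Tendsto ε atTop (𝓝 0)
  ε_sq : IntegrableOn (fun t => dt ε t ^ 2 / ε t) (Ici 0)
  ε_sub : dt ε =o[atTop] ε

/-- The numerator `ε² r`. -/
noncomputable def scaledR (ε α : ℝ → ℝ) (β lam : ℝ) (t : ℝ) : ℝ :=
  (α t + β * lam) ^ 2 / 4 + ε t * dt α t / 2 - (α t + β * lam) * dt ε t / 2 - lam * ε t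

/-- First derivative of `ε² r`. -/
noncomputable def scaledR₁ (ε α : ℝ → ℝ) (β lam : ℝ) (t : ℝ) : ℝ :=
  dt α t * (1 / 2 * (α t + β * lam)) + dt (dt α) t * (1 / 2 * ε t) -
    dt (dt ε) t * (1 / 2 * (α t + β * lam)) - dt ε t * lam

/-- Second derivative of `ε² r`. -/
noncomputable def scaledR₂ (ε α : ℝ → ℝ) (β lam : ℝ) (t : ℝ) : ℝ :=
  dt α t * (1 / 2 * dt α t) + dt (dt α) t * (1 / 2 * (α t + β * lam) + 1 / 2 * dt ε t) +
    dt (dt (dt α)) t * (1 / 2 * ε t) - dt (dt ε) t * (1 / 2 * dt α t + lam) -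
    dt (dt (dt ε)) t * (1 / 2 * (α t + β * lam))

namespace DampingData

variable {ε α : ℝ → ℝ} {β lam : ℝ} (h : DampingData ε α β lam) {t : ℝ}
include h

theorem b_pos (ht : 0 ≤ t) : 0 < α t + β * lam :=
  add_pos_of_nonneg_of_pos (h.α_nonneg t ht) (mul_pos h.β_pos h.lam_pos)

theorem hasDeriv_α (ht : 0 ≤ t) : HasDerivWithinAt α (dt α t) (Ici 0) t :=
  h.α_smooth.hasDerivWithinAt_dt (by norm_num) ht

theorem hasDeriv_dt_α (ht : 0 ≤ t) : HasDerivWithinAt (dt α) (dt (dt α) t) (Ici 0) t :=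
  (h.α_smooth.dt (m := 2) (by norm_num)).hasDerivWithinAt_dt (by norm_num) ht

theorem hasDeriv_dt_dt_α (ht : 0 ≤ t) :
    HasDerivWithinAt (dt (dt α)) (dt (dt (dt α)) t) (Ici 0) t :=
  ((h.α_smooth.dt (m := 2) (by norm_num)).dt (m := 1) (by norm_num)).hasDerivWithinAt_dt
    (by norm_num) ht

theorem hasDeriv_ε (ht : 0 ≤ t) : HasDerivWithinAt ε (dt ε t) (Ici 0) t :=
  h.ε_smooth.hasDerivWithinAt_dt (by norm_num) ht

theorem hasDeriv_dt_ε (ht : 0 ≤ t) : HasDerivWithinAt (dt ε) (dt (dt ε) t) (Ici 0) t :=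
  (h.ε_smooth.dt (m := 2) (by norm_num)).hasDerivWithinAt_dt (by norm_num) ht

theorem hasDeriv_dt_dt_ε (ht : 0 ≤ t) :
    HasDerivWithinAt (dt (dt ε)) (dt (dt (dt ε)) t) (Ici 0) t :=
  ((h.ε_smooth.dt (m := 2) (by norm_num)).dt (m := 1) (by norm_num)).hasDerivWithinAt_dt
    (by norm_num) ht

theorem continuousOn_dt_dt_dt_α : ContinuousOn (dt (dt (dt α))) (Ici 0) :=
  (((h.α_smooth.dt (m := 2) (by norm_num)).dt (m := 1) (by norm_num)).dt (m := 0)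
    (by norm_num)).continuousOn

theorem continuousOn_dt_dt_dt_ε : ContinuousOn (dt (dt (dt ε))) (Ici 0) :=
  (((h.ε_smooth.dt (m := 2) (by norm_num)).dt (m := 1) (by norm_num)).dt (m := 0)
    (by norm_num)).continuousOn

theorem hasDeriv_b (ht : 0 ≤ t) :
    HasDerivWithinAt (fun t => α t + β * lam) (dt α t) (Ici 0) t :=
  (h.hasDeriv_α ht).add_const _

theorem hasDeriv_pFun (ht : 0 ≤ t) : HasDerivWithinAt (pFun ε α β lam)
    ((dt α t * ε t - (α t + β * lam) * dt ε t) / ε t ^ 2) (Ici 0) t :=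
  (h.hasDeriv_b ht).div (h.hasDeriv_ε ht) (h.ε_pos t ht).ne'

theorem rFun_eq (ht : 0 ≤ t) : rFun ε α β lam t = scaledR ε α β lam t / ε t ^ 2 := by
  have := (h.ε_pos t ht).ne'
  rw [rFun, dt, (h.hasDeriv_pFun ht).derivWithin (uniqueDiffWithinAt_Ici_zero ht), pFun, scaledR]
  field_simp
  ring

theorem hasDeriv_scaledR (ht : 0 ≤ t) :
    HasDerivWithinAt (scaledR ε α β lam) (scaledR₁ ε α β lam t) (Ici 0) t := by
  refine ((((((h.hasDeriv_b ht).pow 2).div_const 4).add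
    (((h.hasDeriv_ε ht).mul (h.hasDeriv_dt_α ht)).div_const 2)).sub
    (((h.hasDeriv_b ht).mul (h.hasDeriv_dt_ε ht)).div_const 2)).sub
    ((h.hasDeriv_ε ht).const_mul lam)).congr_deriv ?_
  rw [scaledR₁]
  push_cast
  ring

theorem hasDeriv_scaledR₁ (ht : 0 ≤ t) :
    HasDerivWithinAt (scaledR₁ ε α β lam) (scaledR₂ ε α β lam t) (Ici 0) t := by
  refine (((((h.hasDeriv_dt_α ht).mul ((h.hasDeriv_b ht).const_mul (1 / 2))).add
    ((h.hasDeriv_dt_dt_α ht).mul ((h.hasDeriv_ε ht).const_mul (1 / 2)))).sub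
    ((h.hasDeriv_dt_dt_ε ht).mul ((h.hasDeriv_b ht).const_mul (1 / 2)))).sub
    ((h.hasDeriv_dt_ε ht).mul_const lam)).congr_deriv ?_
  rw [scaledR₂]
  ring

theorem hasDeriv_rFun (ht : 0 ≤ t) : HasDerivWithinAt (rFun ε α β lam)
    (scaledR₁ ε α β lam t / ε t ^ 2 - 2 * scaledR ε α β lam t * dt ε t / ε t ^ 3) (Ici 0) t := by
  have hε := (h.ε_pos t ht).ne'
  refine (((h.hasDeriv_scaledR ht).div ((h.hasDeriv_ε ht).pow 2) (pow_ne_zero 2 hε)).congr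
    (fun s hs => h.rFun_eq hs) (h.rFun_eq ht)).congr_deriv ?_
  simp only [Pi.pow_apply]
  push_cast
  field_simp

theorem dt_rFun (ht : 0 ≤ t) : dt (rFun ε α β lam) t =
    scaledR₁ ε α β lam t / ε t ^ 2 - 2 * scaledR ε α β lam t * dt ε t / ε t ^ 3 :=
  (h.hasDeriv_rFun ht).derivWithin (uniqueDiffWithinAt_Ici_zero ht)

theorem hasDeriv_dt_rFun (ht : 0 ≤ t) : HasDerivWithinAt (dt (rFun ε α β lam))
    (scaledR₂ ε α β lam t / ε t ^ 2 - 4 * scaledR₁ ε α β lam t * dt ε t / ε t ^ 3 -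
      2 * scaledR ε α β lam t * dt (dt ε) t / ε t ^ 3 +
      6 * scaledR ε α β lam t * dt ε t ^ 2 / ε t ^ 4) (Ici 0) t := by
  have hε := (h.ε_pos t ht).ne'
  refine ((((h.hasDeriv_scaledR₁ ht).div ((h.hasDeriv_ε ht).pow 2) (pow_ne_zero 2 hε)).sub
    ((((h.hasDeriv_scaledR ht).const_mul 2).mul (h.hasDeriv_dt_ε ht)).div
      ((h.hasDeriv_ε ht).pow 3) (pow_ne_zero 3 hε))).congr
    (fun s hs => h.dt_rFun hs) (h.dt_rFun ht)).congr_deriv ?_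
  simp only [Pi.pow_apply, Pi.mul_apply]
  push_cast
  field_simp
  ring

theorem dt_dt_rFun (ht : 0 ≤ t) : dt (dt (rFun ε α β lam)) t =
    scaledR₂ ε α β lam t / ε t ^ 2 - 4 * scaledR₁ ε α β lam t * dt ε t / ε t ^ 3 -
      2 * scaledR ε α β lam t * dt (dt ε) t / ε t ^ 3 +
      6 * scaledR ε α β lam t * dt ε t ^ 2 / ε t ^ 4 :=
  (h.hasDeriv_dt_rFun ht).derivWithin (uniqueDiffWithinAt_Ici_zero ht)

theorem dt_ε_nonpos (t : ℝ) : dt ε t ≤ 0 := h.ε_anti.derivWithin_nonpos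

/-- With `b = α + β lam`, the smallness of `ε 0` gives `ε(2|α'| + 4 lam) < b²`, and `-b ε'` is
nonnegative because `ε` decreases. -/
theorem scaledR_pos (ht : 0 ≤ t) : 0 < scaledR ε α β lam t := by
  have hlam := h.lam_pos
  have h1 := h.ε_zero t ht
  have hden : 0 < 2 * |dt α t| + 4 * lam := by positivity
  rw [lt_div_iff₀ hden] at h1
  have h2 : ε t ≤ ε 0 := h.ε_anti self_mem_Ici ht ht
  have hε := h.ε_pos t ht
  have h3 : ε t * (2 * |dt α t| + 4 * lam) < (β * lam) ^ 2 :=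
    (mul_le_mul_of_nonneg_right h2 hden.le).trans_lt h1
  have h4 : (β * lam) ^ 2 ≤ (α t + β * lam) ^ 2 := by
    have := h.α_nonneg t ht
    have := mul_pos h.β_pos hlam
    nlinarith
  have h5 : 0 ≤ (α t + β * lam) * -dt ε t :=
    mul_nonneg (h.b_pos ht).le (neg_nonneg.2 (h.dt_ε_nonpos t))
  have h6 := mul_le_mul_of_nonneg_left (neg_abs_le (dt α t)) hε.le
  rw [scaledR]
  linarith

theorem rFun_pos (ht : 0 ≤ t) : 0 < rFun ε α β lam t := by
  rw [h.rFun_eq ht]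
  exact div_pos (h.scaledR_pos ht) (pow_pos (h.ε_pos t ht) 2)

theorem sqrt_rFun (ht : 0 ≤ t) : √(rFun ε α β lam t) = √(scaledR ε α β lam t) / ε t := by
  rw [h.rFun_eq ht, Real.sqrt_div (h.scaledR_pos ht).le, Real.sqrt_sq (h.ε_pos t ht).le]

/-- With `r = R/ε²` all powers of `ε` cancel except in `ε'²/ε`, which is integrable by assumption.
Each summand is arranged as an integrable factor times a bounded one. -/
theorem phiFun_eq (ht : 0 ≤ t) : phiFun ε α β lam t =
    (scaledR₂ ε α β lam t * (4 * (scaledR ε α β lam t * ε t)) +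
      scaledR₁ ε α β lam t *
        (4 * (scaledR ε α β lam t * dt ε t) + -5 * (ε t * scaledR₁ ε α β lam t)) -
      dt (dt ε) t * (8 * (scaledR ε α β lam t * scaledR ε α β lam t)) +
      dt ε t ^ 2 / ε t * (4 * (scaledR ε α β lam t * scaledR ε α β lam t))) *
    (16 * scaledR ε α β lam t ^ (5 / 2 : ℝ))⁻¹ := by
  have hε := h.ε_pos t ht
  have hR := h.scaledR_pos ht
  have hpow : (ε t ^ 2) ^ (5 / 2 : ℝ) = ε t ^ 5 := by
    rw [← Real.rpow_natCast, ← Real.rpow_mul hε.le, ← Real.rpow_natCast]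
    norm_num
  have hRp : 0 < scaledR ε α β lam t ^ (5 / 2 : ℝ) := Real.rpow_pos_of_pos hR _
  rw [phiFun, h.dt_rFun ht, h.dt_dt_rFun ht, h.rFun_eq ht,
    Real.div_rpow hR.le (pow_pos hε 2).le, hpow]
  field_simp
  ring

theorem tendsto_dt_α : Tendsto (dt α) atTop (𝓝 0) :=
  tendsto_zero_of_integrableOn_dt (fun _ ht => h.hasDeriv_dt_α ht) h.α_int₁ h.α_int₂

theorem tendsto_dt_dt_α : Tendsto (dt (dt α)) atTop (𝓝 0) :=
  tendsto_zero_of_integrableOn_dt (fun _ ht => h.hasDeriv_dt_dt_α ht) h.α_int₂ h.α_int₃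

theorem tendsto_dt_ε : Tendsto (dt ε) atTop (𝓝 0) :=
  tendsto_zero_of_integrableOn_dt (fun _ ht => h.hasDeriv_dt_ε ht) h.ε_int₁ h.ε_int₂

theorem tendsto_dt_dt_ε : Tendsto (dt (dt ε)) atTop (𝓝 0) :=
  tendsto_zero_of_integrableOn_dt (fun _ ht => h.hasDeriv_dt_dt_ε ht) h.ε_int₂ h.ε_int₃

/-- `α` converges because `α'` is integrable; the limit is at least `β lam`, which later keeps `R`
away from `0`. -/
theorem exists_tendsto_b : ∃ L, 0 < L ∧ Tendsto (fun t => α t + β * lam) atTop (𝓝 L) := by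
  have h1 := (tendsto_limUnder_of_hasDerivAt_of_integrableOn_Ioi (a := 0)
    (fun t ht => (h.hasDeriv_b (le_of_lt ht)).hasDerivAt (Ici_mem_nhds ht))
    (h.α_int₁.mono_set Ioi_subset_Ici_self))
  refine ⟨_, (mul_pos h.β_pos h.lam_pos).trans_le (ge_of_tendsto h1 ?_), h1⟩
  filter_upwards [eventually_ge_atTop 0] with t ht
  have := h.α_nonneg t ht
  linarith

theorem tendsto_scaledR {L : ℝ} (hL : Tendsto (fun t => α t + β * lam) atTop (𝓝 L)) :
    Tendsto (scaledR ε α β lam) atTop (𝓝 (L ^ 2 / 4)) := by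
  have := ((((hL.pow 2).div_const 4).add ((h.ε_lim.mul h.tendsto_dt_α).div_const 2)).sub
    ((hL.mul h.tendsto_dt_ε).div_const 2)).sub (h.ε_lim.const_mul lam)
  simpa [funext (fun t => scaledR.eq_1 ε α β lam t)] using this

theorem continuousOn_scaledR : ContinuousOn (scaledR ε α β lam) (Ici 0) :=
  fun _ ht => (h.hasDeriv_scaledR ht).continuousWithinAt

theorem integrableOn_phiFun : IntegrableOn (phiFun ε α β lam) (Ici 0) := by
  obtain ⟨L, hL0, hL⟩ := h.exists_tendsto_b
  have bb : BddContOn fun t => α t + β * lam :=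
    .of_tendsto (fun _ ht => (h.hasDeriv_b ht).continuousWithinAt) hL
  have bε : BddContOn ε := .of_tendsto (fun _ ht => (h.hasDeriv_ε ht).continuousWithinAt) h.ε_lim
  have bα₁ : BddContOn (dt α) :=
    .of_tendsto (fun _ ht => (h.hasDeriv_dt_α ht).continuousWithinAt) h.tendsto_dt_α
  have bα₂ : BddContOn (dt (dt α)) :=
    .of_tendsto (fun _ ht => (h.hasDeriv_dt_dt_α ht).continuousWithinAt) h.tendsto_dt_dt_α
  have bε₁ : BddContOn (dt ε) :=
    .of_tendsto (fun _ ht => (h.hasDeriv_dt_ε ht).continuousWithinAt) h.tendsto_dt_ε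
  have bε₂ : BddContOn (dt (dt ε)) :=
    .of_tendsto (fun _ ht => (h.hasDeriv_dt_dt_ε ht).continuousWithinAt) h.tendsto_dt_dt_ε
  have bR : BddContOn (scaledR ε α β lam) :=
    .of_tendsto h.continuousOn_scaledR (h.tendsto_scaledR hL)
  have bR₁ : BddContOn (scaledR₁ ε α β lam) := by
    have := (((bα₁.mul (bb.const_mul (1 / 2))).add (bα₂.mul (bε.const_mul (1 / 2)))).add
      ((bε₂.mul (bb.const_mul (1 / 2))).const_mul (-1))).add
      ((bε₁.mul (BddContOn.const lam)).const_mul (-1))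
    convert this using 2 with t
    rw [scaledR₁]
    ring
  have iR₁ : IntegrableOn (scaledR₁ ε α β lam) (Ici 0) :=
    (((IntegrableOn.mul_bddContOn h.α_int₁ (bb.const_mul (1 / 2))).add
      (IntegrableOn.mul_bddContOn h.α_int₂ (bε.const_mul (1 / 2)))).sub
      (IntegrableOn.mul_bddContOn h.ε_int₂ (bb.const_mul (1 / 2)))).sub
      (IntegrableOn.mul_bddContOn h.ε_int₁ (BddContOn.const lam))
  have iR₂ : IntegrableOn (scaledR₂ ε α β lam) (Ici 0) :=
    ((((IntegrableOn.mul_bddContOn h.α_int₁ (bα₁.const_mul (1 / 2))).add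
      (IntegrableOn.mul_bddContOn h.α_int₂ ((bb.const_mul (1 / 2)).add
        (bε₁.const_mul (1 / 2))))).add
      (IntegrableOn.mul_bddContOn h.α_int₃ (bε.const_mul (1 / 2)))).sub
      (IntegrableOn.mul_bddContOn h.ε_int₂ ((bα₁.const_mul (1 / 2)).add
        (BddContOn.const lam)))).sub
      (IntegrableOn.mul_bddContOn h.ε_int₃ (bb.const_mul (1 / 2)))
  have bInv : BddContOn fun t => (16 * scaledR ε α β lam t ^ (5 / 2 : ℝ))⁻¹ := by
    have hlim : 0 < L ^ 2 / 4 := by positivity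
    refine .of_tendsto ?_ ((((h.tendsto_scaledR hL).rpow_const
      (Or.inl hlim.ne')).const_mul 16).inv₀ (by positivity))
    refine (continuousOn_const.mul (h.continuousOn_scaledR.rpow_const
      fun t ht => Or.inl (h.scaledR_pos ht).ne')).inv₀ fun t ht => ?_
    exact (mul_pos (by norm_num) (Real.rpow_pos_of_pos (h.scaledR_pos ht) (5 / 2))).ne'
  have key := IntegrableOn.mul_bddContOn
    ((((IntegrableOn.mul_bddContOn iR₂ ((bR.mul bε).const_mul 4)).add
      (IntegrableOn.mul_bddContOn iR₁ (((bR.mul bε₁).const_mul 4).add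
        ((bε.mul bR₁).const_mul (-5))))).sub
      (IntegrableOn.mul_bddContOn h.ε_int₂ ((bR.mul bR).const_mul 8))).add
      (IntegrableOn.mul_bddContOn h.ε_sq ((bR.mul bR).const_mul 4))) bInv
  exact key.congr_fun (fun t ht => (h.phiFun_eq ht).symm) measurableSet_Ici

theorem continuousOn_pFun : ContinuousOn (pFun ε α β lam) (Ici 0) :=
  fun _ ht => (h.hasDeriv_pFun ht).continuousWithinAt

theorem continuousOn_rFun : ContinuousOn (rFun ε α β lam) (Ici 0) :=
  fun _ ht => (h.hasDeriv_rFun ht).continuousWithinAt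

theorem continuousOn_phiFun : ContinuousOn (phiFun ε α β lam) (Ici 0) := by
  have cε : ContinuousOn ε (Ici 0) := h.ε_smooth.continuousOn
  have cα : ContinuousOn α (Ici 0) := h.α_smooth.continuousOn
  have cα₁ : ContinuousOn (dt α) (Ici 0) := fun _ ht => (h.hasDeriv_dt_α ht).continuousWithinAt
  have cα₂ : ContinuousOn (dt (dt α)) (Ici 0) :=
    fun _ ht => (h.hasDeriv_dt_dt_α ht).continuousWithinAt
  have cε₁ : ContinuousOn (dt ε) (Ici 0) := fun _ ht => (h.hasDeriv_dt_ε ht).continuousWithinAt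
  have cε₂ : ContinuousOn (dt (dt ε)) (Ici 0) :=
    fun _ ht => (h.hasDeriv_dt_dt_ε ht).continuousWithinAt
  have cα₃ := h.continuousOn_dt_dt_dt_α
  have cε₃ := h.continuousOn_dt_dt_dt_ε
  have cR := h.continuousOn_scaledR
  have cR₁ : ContinuousOn (scaledR₁ ε α β lam) (Ici 0) :=
    fun _ ht => (h.hasDeriv_scaledR₁ ht).continuousWithinAt
  have cR₂ : ContinuousOn (scaledR₂ ε α β lam) (Ici 0) := by
    unfold scaledR₂
    fun_prop
  have cInv : ContinuousOn (fun t => (16 * scaledR ε α β lam t ^ (5 / 2 : ℝ))⁻¹) (Ici 0) := by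
    refine (continuousOn_const.mul (cR.rpow_const
      fun t ht => Or.inl (h.scaledR_pos ht).ne')).inv₀ fun t ht => ?_
    exact (mul_pos (by norm_num) (Real.rpow_pos_of_pos (h.scaledR_pos ht) (5 / 2))).ne'
  have cdiv : ContinuousOn (fun t => dt ε t ^ 2 / ε t) (Ici 0) :=
    (cε₁.pow 2).div cε fun t ht => (h.ε_pos t ht).ne'
  refine ContinuousOn.congr ?_ fun t ht => h.phiFun_eq ht
  fun_prop

end DampingData

/-! ### Expansion of the exponents. -/

/-- The remainder in the expansion of `-p/2 + √r`. -/
noncomputable def lgRemainder (ε α : ℝ → ℝ) (β lam : ℝ) (t : ℝ) : ℝ :=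
  -(pFun ε α β lam t / 2) + √(rFun ε α β lam t) -
    (dt α t / (2 * (α t + β * lam)) - dt ε t / (2 * ε t)) +
    lam / (α t + β * lam) + lam ^ 2 * ε t / (α t + β * lam) ^ 3

theorem DampingData.lgRemainder_isLittleO {ε α : ℝ → ℝ} {β lam : ℝ}
    (h : DampingData ε α β lam) : lgRemainder ε α β lam =o[atTop] ε := by
  have hev : ∀ᶠ t in atTop, ε t = 0 → lgRemainder ε α β lam t = 0 := by
    filter_upwards [eventually_ge_atTop 0] with t ht h0
    exact absurd h0 (h.ε_pos t ht).ne'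
  rw [isLittleO_iff_tendsto' hev]
  obtain ⟨L, hL0, hL⟩ := h.exists_tendsto_b
  have hR := (h.tendsto_scaledR hL).sqrt
  have hsL : √(L ^ 2 / 4) = L / 2 := by
    rw [show L ^ 2 / 4 = (L / 2) ^ 2 by ring, Real.sqrt_sq (by positivity)]
  rw [hsL] at hR
  have hsub : Tendsto (fun t => dt ε t / ε t) atTop (𝓝 0) := h.ε_sub.tendsto_div_nhds_zero
  have hd : Tendsto (fun t => dt α t / 2 - (α t + β * lam) * (dt ε t / ε t) / 2 - lam) atTop
      (𝓝 (0 / 2 - L * 0 / 2 - lam)) :=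
    ((h.tendsto_dt_α.div_const 2).sub ((hL.mul hsub).div_const 2)).sub_const lam
  -- With `b = α + β lam`, `S = √(ε² r)` and `d = α'/2 - b ε'/(2ε) - lam`, the remainder over `ε`
  -- equals exactly `lam²/b³ - d²/(b (S + b/2)²)`. Since `d → -lam`, `b → L` and `S → L/2`, the two
  -- terms cancel in the limit.
  have hlim := ((tendsto_const_nhds (x := lam ^ 2)).div (hL.pow 3) (by positivity)).sub
    ((hd.pow 2).div (hL.mul ((hR.add (hL.div_const 2)).pow 2)) (by positivity))
  have hz : lam ^ 2 / L ^ 3 - (0 / 2 - L * 0 / 2 - lam) ^ 2 / (L * (L / 2 + L / 2) ^ 2) = 0 := by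
    field_simp
    ring
  rw [hz] at hlim
  refine hlim.congr' ?_
  filter_upwards [eventually_ge_atTop 0] with t ht
  have hε := (h.ε_pos t ht).ne'
  have hb := h.b_pos ht
  have hS : √(scaledR ε α β lam t) ^ 2 = (α t + β * lam) ^ 2 / 4 + ε t * dt α t / 2 -
      (α t + β * lam) * dt ε t / 2 - lam * ε t := Real.sq_sqrt (h.scaledR_pos ht).le
  have hS0 : 0 ≤ √(scaledR ε α β lam t) := Real.sqrt_nonneg _
  rw [lgRemainder, h.sqrt_rFun ht, pFun]
  simp only [Pi.div_apply]
  generalize √(scaledR ε α β lam t) = S at *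
  generalize α t + β * lam = b at *
  have hSb : S + b / 2 ≠ 0 := by positivity
  -- Difference of squares: `S² - b²/4 = ε d`, so `(S - b/2)/ε = d/(S + b/2)`.
  have hd1 : dt α t / 2 - b * (dt ε t / ε t) / 2 - lam = (S - b / 2) * (S + b / 2) / ε t := by
    field_simp
    linarith
  have hd2 : dt α t / (2 * b) - dt ε t / (2 * ε t) =
      ((S - b / 2) * (S + b / 2) / ε t + lam) / b := by
    rw [← hd1]
    field_simp
    ring
  rw [hd1, hd2]
  field_simp
  ring

/-! ### Liouville-Green data of the damped equation. -/

theorem ContinuousOn.continuous_comp_max {f : ℝ → ℝ} (hf : ContinuousOn f (Ici 0)) :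
    Continuous fun t => f (max t 0) :=
  hf.comp_continuous (continuous_id.max continuous_const) fun t => mem_Ici.2 (le_max_right t 0)

/-- `√r`, extended by a constant to the left of `0`. -/
noncomputable def lgRate (ε α : ℝ → ℝ) (β lam t : ℝ) : ℝ := √(rFun ε α β lam (max t 0))

/-- `φ`, extended by a constant to the left of `0`. -/
noncomputable def lgError (ε α : ℝ → ℝ) (β lam t : ℝ) : ℝ := phiFun ε α β lam (max t 0)

/-- The exponent `∫_0^t (-p/2 + √r)`. -/
noncomputable def lgExponent (ε α : ℝ → ℝ) (β lam t : ℝ) : ℝ :=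
  ∫ s in (0 : ℝ)..t, (-(pFun ε α β lam (max s 0) / 2) + lgRate ε α β lam s)

/-- The factor `exp (∫_0^t (-p/2 + √r)) / r^(1/4)`. -/
noncomputable def lgAmplitude (ε α : ℝ → ℝ) (β lam t : ℝ) : ℝ :=
  Real.exp (lgExponent ε α β lam t) / rFun ε α β lam t ^ (1 / 4 : ℝ)

/-- The ratio `exp (-2 ∫_0^t √r)` of the exponential factors. -/
noncomputable def lgRatio (ε α : ℝ → ℝ) (β lam : ℝ) : ℝ → ℝ := decayFactor (lgRate ε α β lam)

namespace DampingData

variable {ε α : ℝ → ℝ} {β lam : ℝ} (h : DampingData ε α β lam) {t : ℝ}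
include h

theorem continuous_lgRate : Continuous (lgRate ε α β lam) :=
  h.continuousOn_rFun.continuous_comp_max.sqrt

theorem continuous_lgError : Continuous (lgError ε α β lam) :=
  h.continuousOn_phiFun.continuous_comp_max

theorem integrableOn_lgError : IntegrableOn (lgError ε α β lam) (Ioi 0) :=
  (h.integrableOn_phiFun.mono_set Ioi_subset_Ici_self).congr_fun
    (fun t ht => by rw [lgError, max_eq_left (le_of_lt ht)]) measurableSet_Ioi

theorem continuous_lgExponent_integrand :
    Continuous fun s => -(pFun ε α β lam (max s 0) / 2) + lgRate ε α β lam s :=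
  (h.continuousOn_pFun.continuous_comp_max.div_const 2).neg.add h.continuous_lgRate

theorem lgAmplitude_zero_pos : 0 < lgAmplitude ε α β lam 0 :=
  div_pos (Real.exp_pos _) (Real.rpow_pos_of_pos (h.rFun_pos le_rfl) _)

/-- Solutions of the Volterra equation give solutions of the differential equation. -/
theorem isSolution_of_volterraEq {k₀ k₁ : ℝ} {W : ℝ → ℝ} (hWc : Continuous W)
    (hW : VolterraEq (lgRatio ε α β lam) (lgError ε α β lam) k₀ k₁ W) :
    IsSolution ε α β lam (fun t => lgAmplitude ε α β lam t * W t) ∧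
    lgAmplitude ε α β lam 0 * W 0 = lgAmplitude ε α β lam 0 * (k₀ + k₁) ∧
    dt (fun t => lgAmplitude ε α β lam t * W t) 0 = lgAmplitude ε α β lam 0 *
      ((-(pFun ε α β lam 0 / 2) + √(rFun ε α β lam 0) -
        dt (rFun ε α β lam) 0 / (4 * rFun ε α β lam 0)) * (k₀ + k₁) -
          2 * √(rFun ε α β lam 0) * k₁) := by
  have hσ := h.continuous_lgRate
  have hφ := h.continuous_lgError
  have hqc : Continuous (lgRatio ε α β lam) := continuous_decayFactor hσ
  have hq : ∀ t, 0 < lgRatio ε α β lam t := decayFactor_pos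
  have hrate : ∀ t, 0 ≤ t → lgRate ε α β lam t = √(rFun ε α β lam t) := fun t ht => by
    rw [lgRate, max_eq_left ht]
  have hqd : ∀ t, 0 ≤ t → HasDerivWithinAt (lgRatio ε α β lam)
      (-2 * √(rFun ε α β lam t) * lgRatio ε α β lam t) (Ici 0) t := fun t ht => by
    rw [← hrate t ht]
    exact hasDerivWithinAt_decayFactor hσ ht
  have hd : Continuous fun s => lgError ε α β lam s * W s / lgRatio ε α β lam s :=
    (hφ.mul hWc).div hqc fun s => (hq s).ne'
  obtain ⟨v, a, hva⟩ := hasDerivWithinAt_liouvilleGreen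
    (p := pFun ε α β lam) (p' := dt (pFun ε α β lam)) (r := rFun ε α β lam)
    (r' := dt (rFun ε α β lam)) (r'' := dt (dt (rFun ε α β lam))) (m := fun t => lam / ε t)
    (φ := lgError ε α β lam) (I := lgExponent ε α β lam) (q := lgRatio ε α β lam) (W := W)
    (Z := fun t => k₁ - 1 / 2 * ∫ s in (0 : ℝ)..t, lgError ε α β lam s * W s / lgRatio ε α β lam s)
    (fun t ht => (h.hasDeriv_pFun ht).differentiableWithinAt.hasDerivWithinAt)
    (fun t ht => (h.hasDeriv_rFun ht).differentiableWithinAt.hasDerivWithinAt)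
    (fun t ht => (h.hasDeriv_dt_rFun ht).differentiableWithinAt.hasDerivWithinAt)
    (fun t ht => h.rFun_pos ht) (fun t _ => rfl)
    (fun t ht => by rw [lgError, max_eq_left ht, phiFun])
    (fun t ht => by
      have := (hasDerivAt_integral_zero h.continuous_lgExponent_integrand t).hasDerivWithinAt
        (s := Ici 0)
      rw [max_eq_left ht, hrate t ht] at this
      exact this)
    hqd hq (fun t ht => hW.hasDerivWithinAt hqc hq hφ hWc hqd ht)
    (fun t _ =>
      (((hasDerivAt_integral_zero hd t).const_mul (1 / 2)).const_sub k₁).hasDerivWithinAt)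
  have hq0 : lgRatio ε α β lam 0 = 1 := by simp [lgRatio, decayFactor]
  have hW0 : W 0 = k₀ + k₁ := by
    have := hW 0 le_rfl
    simpa [hq0] using this
  refine ⟨⟨v, a, fun t ht => ?_⟩, by rw [hW0], ?_⟩
  · obtain ⟨h1, h2, h3, -⟩ := hva t ht
    refine ⟨h1, h2, ?_⟩
    have hε := (h.ε_pos t ht).ne'
    have e : ε t * a t + (α t + β * lam) * v t + lam * (lgAmplitude ε α β lam t * W t) =
        ε t * (a t + pFun ε α β lam t * v t + lam / ε t * (lgAmplitude ε α β lam t * W t)) := by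
      rw [pFun]
      field_simp
    rw [e]
    exact mul_eq_zero_of_right _ h3
  · obtain ⟨h1, -, -, h4⟩ := hva 0 le_rfl
    refine (h1.derivWithin (uniqueDiffWithinAt_Ici_zero le_rfl)).trans ?_
    rw [h4, hW0, hq0]
    simp [lgAmplitude]

theorem intervalIntegrable_log_deriv (ht : 0 ≤ t) : IntervalIntegrable
    (fun s => dt α s / (2 * (α s + β * lam)) - dt ε s / (2 * ε s)) volume 0 t := by
  have hsub : Icc 0 t ⊆ Ici (0 : ℝ) := Icc_subset_Ici_self
  have cb : ContinuousOn (fun s => α s + β * lam) (Ici 0) :=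
    fun _ hs => (h.hasDeriv_b hs).continuousWithinAt
  have cε : ContinuousOn ε (Ici 0) := h.ε_smooth.continuousOn
  have cα₁ : ContinuousOn (dt α) (Ici 0) := fun _ ht => (h.hasDeriv_dt_α ht).continuousWithinAt
  have cε₁ : ContinuousOn (dt ε) (Ici 0) := fun _ ht => (h.hasDeriv_dt_ε ht).continuousWithinAt
  refine ContinuousOn.intervalIntegrable ?_
  rw [uIcc_of_le ht]
  refine ContinuousOn.sub ?_ ?_
  · exact (cα₁.mono hsub).div (continuousOn_const.mul (cb.mono hsub))
      fun s hs => (mul_pos two_pos (h.b_pos hs.1)).ne'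
  · exact (cε₁.mono hsub).div (continuousOn_const.mul (cε.mono hsub))
      fun s hs => (mul_pos two_pos (h.ε_pos s hs.1)).ne'

theorem exp_integral_log_deriv (ht : 0 ≤ t) :
    Real.exp (∫ s in (0 : ℝ)..t, (dt α s / (2 * (α s + β * lam)) - dt ε s / (2 * ε s))) =
      √(α t + β * lam) / √(ε t) / (√(α 0 + β * lam) / √(ε 0)) := by
  have hsub : Icc 0 t ⊆ Ici (0 : ℝ) := Icc_subset_Ici_self
  have cb : ContinuousOn (fun s => α s + β * lam) (Ici 0) :=
    fun _ hs => (h.hasDeriv_b hs).continuousWithinAt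
  have cε : ContinuousOn ε (Ici 0) := h.ε_smooth.continuousOn
  have hint : ∫ s in (0 : ℝ)..t, (dt α s / (2 * (α s + β * lam)) - dt ε s / (2 * ε s)) =
      (Real.log (α t + β * lam) / 2 - Real.log (ε t) / 2) -
        (Real.log (α 0 + β * lam) / 2 - Real.log (ε 0) / 2) := by
    refine intervalIntegral.integral_eq_sub_of_hasDerivAt_of_le
      (f := fun s => Real.log (α s + β * lam) / 2 - Real.log (ε s) / 2) ht ?_ (fun s hs => ?_) ?_
    · exact (((cb.mono hsub).log fun s hs => (h.b_pos hs.1).ne').div_const 2).sub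
        (((cε.mono hsub).log fun s hs => (h.ε_pos s hs.1).ne').div_const 2)
    · have hb := h.b_pos hs.1.le
      have hε := h.ε_pos s hs.1.le
      have d1 := (h.hasDeriv_b hs.1.le).hasDerivAt (Ici_mem_nhds hs.1)
      have d2 := (h.hasDeriv_ε hs.1.le).hasDerivAt (Ici_mem_nhds hs.1)
      refine (((d1.log hb.ne').div_const 2).sub ((d2.log hε.ne').div_const 2)).congr_deriv ?_
      field_simp
    · exact h.intervalIntegrable_log_deriv ht
  have hs : ∀ x, 0 < x → Real.exp (Real.log x / 2) = √x := fun x hx => by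
    rw [Real.exp_half, Real.exp_log hx]
  rw [hint, Real.exp_sub, Real.exp_sub, Real.exp_sub, hs _ (h.b_pos ht), hs _ (h.ε_pos t ht),
    hs _ (h.b_pos le_rfl), hs _ (h.ε_pos 0 le_rfl)]

/-- The part of `-p/2 + √r` missing from the exponent is the logarithmic derivative of `√(b/ε)`,
with `b = α + β lam`. Its integral supplies the algebraic prefactor, up to the value at `0`. -/
theorem lgTerm₁_eq (δ : ℝ → ℝ) (ht : 0 ≤ t) :
    lgTerm₁ ε α β lam δ (lgRemainder ε α β lam) t = √(α 0 + β * lam) / √(ε 0) *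
      (lgAmplitude ε α β lam t * (1 + δ t)) := by
  have hI : ∫ s in (0 : ℝ)..t, (-(lam / (α s + β * lam)) -
      lam ^ 2 * ε s / (α s + β * lam) ^ 3 + lgRemainder ε α β lam s) =
      lgExponent ε α β lam t -
        ∫ s in (0 : ℝ)..t, (dt α s / (2 * (α s + β * lam)) - dt ε s / (2 * ε s)) := by
    rw [lgExponent, ← intervalIntegral.integral_sub
      (h.continuous_lgExponent_integrand.intervalIntegrable _ _)
      (h.intervalIntegrable_log_deriv ht)]
    refine intervalIntegral.integral_congr fun s hs => ?_
    rw [uIcc_of_le ht] at hs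
    simp only [lgRate, max_eq_left hs.1, lgRemainder]
    ring
  have h1 := Real.sqrt_pos.2 (h.b_pos ht)
  have h2 := Real.sqrt_pos.2 (h.ε_pos t ht)
  have h3 := Real.sqrt_pos.2 (h.b_pos le_rfl)
  have h4 := Real.sqrt_pos.2 (h.ε_pos 0 le_rfl)
  have h5 := Real.rpow_pos_of_pos (h.rFun_pos ht) (1 / 4)
  rw [lgTerm₁, hI, Real.exp_sub, h.exp_integral_log_deriv ht, lgAmplitude]
  field_simp

/-- The fast exponent is the slow one minus `2√r`, whence the factor `lgRatio`. The two exponents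
sum to `-p`, so the second remainder is minus the first. -/
theorem lgTerm₂_eq (δ : ℝ → ℝ) (ht : 0 ≤ t) :
    lgTerm₂ ε α β lam δ (fun t => -lgRemainder ε α β lam t) t =
      (√(α 0 + β * lam) / √(ε 0))⁻¹ *
        (lgAmplitude ε α β lam t * (lgRatio ε α β lam t * (1 + δ t))) := by
  have hI : ∫ s in (0 : ℝ)..t, (-((α s + β * lam) / ε s) + lam / (α s + β * lam) +
        lam ^ 2 * ε s / (α s + β * lam) ^ 3 + -lgRemainder ε α β lam s) =
      (lgExponent ε α β lam t + -2 * ∫ s in (0 : ℝ)..t, lgRate ε α β lam s) +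
        ∫ s in (0 : ℝ)..t, (dt α s / (2 * (α s + β * lam)) - dt ε s / (2 * ε s)) := by
    have hi := h.continuous_lgExponent_integrand.intervalIntegrable (μ := volume) 0 t
    have hr := (h.continuous_lgRate.intervalIntegrable (μ := volume) 0 t).const_mul (-2)
    rw [lgExponent, ← intervalIntegral.integral_const_mul,
      ← intervalIntegral.integral_add hi hr,
      ← intervalIntegral.integral_add (hi.add hr) (h.intervalIntegrable_log_deriv ht)]
    refine intervalIntegral.integral_congr fun s hs => ?_
    rw [uIcc_of_le ht] at hs
    simp only [lgRate, max_eq_left hs.1, lgRemainder, pFun]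
    ring
  have h1 := Real.sqrt_pos.2 (h.b_pos ht)
  have h2 := Real.sqrt_pos.2 (h.ε_pos t ht)
  have h3 := Real.sqrt_pos.2 (h.b_pos le_rfl)
  have h4 := Real.sqrt_pos.2 (h.ε_pos 0 le_rfl)
  have h5 := Real.rpow_pos_of_pos (h.rFun_pos ht) (1 / 4)
  have hq : lgRatio ε α β lam t = Real.exp (-2 * ∫ s in (0 : ℝ)..t, lgRate ε α β lam s) := by
    rw [lgRatio, decayFactor, max_eq_left ht]
  rw [lgTerm₂, hI, Real.exp_add, Real.exp_add, h.exp_integral_log_deriv ht, lgAmplitude, hq]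
  field_simp

end DampingData

theorem forwardWeight_lgError (ε α : ℝ → ℝ) (β lam : ℝ) {t : ℝ} (ht : 0 ≤ t) :
    forwardWeight (lgError ε α β lam) t =
      Real.exp (1 / 2 * ∫ s in (0 : ℝ)..t, |phiFun ε α β lam s|) := by
  rw [forwardWeight, max_eq_left ht]
  congr 2
  refine intervalIntegral.integral_congr fun s hs => ?_
  rw [uIcc_of_le ht] at hs
  simp only [lgError, max_eq_left hs.1]

theorem backwardWeight_lgError (ε α : ℝ → ℝ) (β lam : ℝ) {t : ℝ} (ht : 0 ≤ t) :
    backwardWeight (lgError ε α β lam) t =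
      Real.exp (1 / 2 * ∫ s in Ioi t, |phiFun ε α β lam s|) := by
  rw [backwardWeight, max_eq_left ht]
  congr 2
  refine setIntegral_congr_fun measurableSet_Ioi fun s hs => ?_
  simp only [lgError, max_eq_left (ht.trans (le_of_lt hs))]

/-! ### Assembly of the theorem. -/

theorem theorem4 (ε α : ℝ → ℝ) (β lam : ℝ) (hβ : 0 < β) (hlam : 0 < lam)
    -- standing assumptions on the damping and the variable mass
    (hα_anti : AntitoneOn α (Ici 0)) (hα_nonneg : ∀ t : ℝ, 0 ≤ t → 0 ≤ α t)
    (hε_anti : AntitoneOn ε (Ici 0)) (hε_pos : ∀ t : ℝ, 0 ≤ t → 0 < ε t)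
    -- smoothness, and smallness of `ε 0`
    (hα_smooth : ContDiffOn ℝ 3 α (Ici 0)) (hε_smooth : ContDiffOn ℝ 3 ε (Ici 0))
    (hε_zero : ∀ t : ℝ, 0 ≤ t → ε 0 < (β * lam) ^ 2 / (2 * |dt α t| + 4 * lam))
    -- integrability of the derivatives and decay of `ε`
    (hα_int₁ : IntegrableOn (dt α) (Ici 0))
    (hα_int₂ : IntegrableOn (dt (dt α)) (Ici 0))
    (hα_int₃ : IntegrableOn (dt (dt (dt α))) (Ici 0))
    (hε_int₁ : IntegrableOn (dt ε) (Ici 0))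
    (hε_int₂ : IntegrableOn (dt (dt ε)) (Ici 0))
    (hε_int₃ : IntegrableOn (dt (dt (dt ε))) (Ici 0))
    (hε_lim : Tendsto ε atTop (𝓝 0))
    (hε_sq : IntegrableOn (fun t => dt ε t ^ 2 / ε t) (Ici 0))
    -- `ε` decays subexponentially
    (hε_sub : dt ε =o[atTop] ε) :
    (∀ t : ℝ, 0 ≤ t → 0 < rFun ε α β lam t) ∧
    IntegrableOn (phiFun ε α β lam) (Ici 0) ∧
    ∃ η₁ η₂ : ℝ → ℝ,
      -- the remainders are `o(ε)`, and they are those of the expansions of `-p/2 ± √r`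
      η₁ =o[atTop] ε ∧ η₂ =o[atTop] ε ∧
      (∀ t : ℝ, 0 ≤ t →
        -(pFun ε α β lam t / 2) + √(rFun ε α β lam t) =
          dt α t / (2 * (α t + β * lam)) - dt ε t / (2 * ε t)
            + (-(lam / (α t + β * lam)) - lam ^ 2 * ε t / (α t + β * lam) ^ 3 + η₁ t)) ∧
      (∀ t : ℝ, 0 ≤ t →
        -(pFun ε α β lam t / 2) - √(rFun ε α β lam t) =
          -(dt α t / (2 * (α t + β * lam))) + dt ε t / (2 * ε t)
            + (-((α t + β * lam) / ε t) + lam / (α t + β * lam)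
              + lam ^ 2 * ε t / (α t + β * lam) ^ 3 + η₂ t)) ∧
      -- each of the two forms is an exact solution, for suitable errors within the bounds
      (∃ δ₁ δ₂ : ℝ → ℝ, ErrorBounds ε α β lam δ₁ δ₂ ∧
        IsSolution ε α β lam (lgTerm₁ ε α β lam δ₁ η₁) ∧
        IsSolution ε α β lam (lgTerm₂ ε α β lam δ₂ η₂)) ∧
      -- for all initial data, there is exactly one solution, and it has the stated form
      ∀ x₀ v₀ : ℝ, ∃ x : ℝ → ℝ,
        (IsSolution ε α β lam x ∧ x 0 = x₀ ∧ dt x 0 = v₀) ∧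
        (∀ y : ℝ → ℝ, IsSolution ε α β lam y → y 0 = x₀ → dt y 0 = v₀ →
          ∀ t : ℝ, 0 ≤ t → y t = x t) ∧
        ∃ (A B : ℝ) (δ₁ δ₂ : ℝ → ℝ), ErrorBounds ε α β lam δ₁ δ₂ ∧
          ContinuousOn δ₁ (Ici 0) ∧ ContinuousOn δ₂ (Ici 0) ∧
          ∀ t : ℝ, 0 ≤ t →
            x t = A * lgTerm₁ ε α β lam δ₁ η₁ t + B * lgTerm₂ ε α β lam δ₂ η₂ t := by
  have h : DampingData ε α β lam := ⟨hβ, hlam, hα_nonneg, hε_anti, hε_pos, hα_smooth, hε_smooth,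
    hε_zero, hα_int₁, hα_int₂, hα_int₃, hε_int₁, hε_int₂, hε_int₃, hε_lim, hε_sq, hε_sub⟩
  have hσ := h.continuous_lgRate
  have hσ0 : ∀ t, 0 ≤ lgRate ε α β lam t := fun t => Real.sqrt_nonneg _
  obtain ⟨w₁, w₂, hw₁, hw₂, hV₁, ⟨l₀, l₁, hV₂⟩, hbd, hrep⟩ :=
    exists_liouvilleGreen_volterra (q := lgRatio ε α β lam) (φ := lgError ε α β lam)
      (continuous_decayFactor hσ) decayFactor_pos (decayFactor_le_one hσ0)
      (antitone_decayFactor hσ hσ0) decayFactor_max h.continuous_lgError h.integrableOn_lgError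
  set C := √(α 0 + β * lam) / √(ε 0) with hC
  have hC0 : 0 < C := div_pos (Real.sqrt_pos.2 (h.b_pos le_rfl))
    (Real.sqrt_pos.2 (h.ε_pos 0 le_rfl))
  have hscale : ∀ {k₀ k₁ : ℝ} {W y : ℝ → ℝ} (c : ℝ), Continuous W →
      VolterraEq (lgRatio ε α β lam) (lgError ε α β lam) k₀ k₁ W →
      (∀ t, 0 ≤ t → y t = c * (lgAmplitude ε α β lam t * W t)) → IsSolution ε α β lam y := by
    intro k₀ k₁ W y c hWc hW hy
    have hlc := hW.lincomb (continuous_decayFactor hσ) decayFactor_pos h.continuous_lgError hWc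
      hWc hW c 0
    refine (h.isSolution_of_volterraEq (by fun_prop) hlc).1.congr fun t ht => ?_
    rw [hy t ht]
    ring
  refine ⟨fun t ht => h.rFun_pos ht, h.integrableOn_phiFun, lgRemainder ε α β lam,
    fun t => -lgRemainder ε α β lam t, h.lgRemainder_isLittleO, h.lgRemainder_isLittleO.neg_left,
    fun t _ => ?_, fun t _ => ?_, ⟨fun t => w₁ t - 1, fun t => w₂ t - 1, fun t ht => ?_, ?_, ?_⟩,
    fun x₀ v₀ => ?_⟩
  · rw [lgRemainder]
    ring
  · simp only [lgRemainder, pFun]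
    ring
  · rw [← forwardWeight_lgError ε α β lam ht, ← backwardWeight_lgError ε α β lam ht]
    exact hbd t ht
  · refine hscale C hw₁ hV₁ fun t ht => ?_
    rw [h.lgTerm₁_eq _ ht, add_sub_cancel]
  · refine hscale C⁻¹ ((continuous_decayFactor hσ).mul hw₂) hV₂ fun t ht => ?_
    rw [h.lgTerm₂_eq _ ht, add_sub_cancel]
    rfl
  · set P₀ := lgAmplitude ε α β lam 0 with hP₀
    have hP₀0 : 0 < P₀ := h.lgAmplitude_zero_pos
    set S := √(rFun ε α β lam 0) with hS
    have hS0 : 0 < S := Real.sqrt_pos.2 (h.rFun_pos le_rfl)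
    set g := -(pFun ε α β lam 0 / 2) + S - dt (rFun ε α β lam) 0 / (4 * rFun ε α β lam 0) with hg
    -- The constants solve `P₀ (k₀ + k₁) = x₀` and `P₀ (g (k₀ + k₁) - 2 S k₁) = v₀`, the initial
    -- values of `P W`.
    obtain ⟨W, hWc, hW, A, B, δ₁, δ₂, hδ₁, hδ₂, hδ⟩ :=
      hrep (x₀ / P₀ - (g * x₀ - v₀) / (2 * S * P₀)) ((g * x₀ - v₀) / (2 * S * P₀))
    obtain ⟨hsol, hx0, hv0⟩ := h.isSolution_of_volterraEq hWc hW
    rw [← hP₀] at hx0 hv0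
    rw [← hS, ← hg] at hv0
    have hx0' : lgAmplitude ε α β lam 0 * W 0 = x₀ := by
      rw [← hP₀, hx0]
      field_simp
      ring
    have hv0' : dt (fun t => lgAmplitude ε α β lam t * W t) 0 = v₀ := by
      rw [hv0]
      field_simp
      ring
    -- Dividing and multiplying by `C` undoes the normalisations of the two terms at `0`.
    refine ⟨fun t => lgAmplitude ε α β lam t * W t, ⟨hsol, hx0', hv0'⟩, fun y hy hy0 hyd t ht => ?_,
      A / C, B * C, δ₁, δ₂, fun t ht => ?_, hδ₁, hδ₂, fun t ht => ?_⟩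
    · exact hsol.eq_of_initial hε_smooth.continuousOn hε_pos hα_smooth.continuousOn hy
        (hy0.trans hx0'.symm) (hyd.trans hv0'.symm) ht
    · rw [← forwardWeight_lgError ε α β lam ht, ← backwardWeight_lgError ε α β lam ht]
      exact ⟨(hδ t ht).1, (hδ t ht).2.1⟩
    · beta_reduce
      rw [h.lgTerm₁_eq _ ht, h.lgTerm₂_eq _ ht, (hδ t ht).2.2, ← hC]
      field_simp
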